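/- For $\lambda\in\mathbb{C}$ with $|\lambda|=1$ let $F_\lambda:\mathbb{C}\to\mathbb{C}$, $F_\lambda(z)=\lambda\,(z-H(z))$, where $H(z)=1$ if $\operatorname{Im} z\ge 0$ and $H(z)=-1$ if $\operatorname{Im} z<0$. Let $\mathcal{F}=\{z\in\mathbb{C} : \operatorname{Im}(F_\lambda^i(z))=0 \text{ for some integer } i\ge 0\}$ be the critical set and $\mathcal{U}=\mathbb{C}\setminus\overline{\mathcal{F}}$ the regular set. Let $p,q\in\mathbb{N}$ with $\gcd(p,q)=1$ and $q\ge 3$, and let $\lambda=e^{2\pi i p/q}$. Then every connected component $V$ of $\mathcal{U}$ is open, bounded and periodic under $F_\lambda$, i.e. $F_\lambda^n(V)=V$ for some $n\ge 1$. Let $\ell=\ell(V)$ be the least such $n$. Then the sets $V,F_\lambda(V),\dots,F_\lambda^{\ell-1}(V)$ are pairwise disjoint connected components of $\mathcal{U}$, cyclically permuted by $F_\lambda$ and each invariant under $F_\lambda^\ell$, and there is an integer $k=k(V)\ge 1$ such that on each of these components $F_\lambda^\ell$ coincides with a rotation of order exactly $k$ (the identity if $k=1$) about a center $c$ lying in that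 component. The center $c$ is a periodic point of $F_\lambda$ of least period $\ell$, and all other points of the component are periodic of least period $k\ell$. (If $k=1$, a suitable point of the component is taken as center.) The numbers $k$ and $\ell$ depend on the component: for every such $\lambda$, the period $\ell(V)$ is unbounded as $V$ ranges over the connected components of $\mathcal{U}$; and there are $p,q$ as above for which the order $k(V)$ is not the same for all components. -/

import Mathlib

open Complex Set

/-- The step function `H`: it is `1` on the closed upper half-plane and `-1` on the open lower one. -/
noncomputable def stepH (z : ℂ) : ℂ :=
  if 0 ≤ z.im then 1 else -1

/-- The piecewise rotation `F_l(z) = l (z - H(z))`. -/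
noncomputable def pwRot (l : ℂ) (z : ℂ) : ℂ :=
  l * (z - stepH z)

/-- The multiplier `exp(i a)` for the angle `a = 2 π p / q`. -/
noncomputable def rotMult (p q : ℕ) : ℂ :=
  Complex.exp (((2 * Real.pi * (p : ℝ) / (q : ℝ) : ℝ) : ℂ) * Complex.I)

/-- The critical set: all points whose forward orbit (time `0` included) meets the real line. -/
def criticalSet (l : ℂ) : Set ℂ :=
  {z | ∃ i : ℕ, ((pwRot l)^[i] z).im = 0}

/-- The regular set: the complement of the closure of the critical set. -/
def regularSet (l : ℂ) : Set ℂ :=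
  (closure (criticalSet l))ᶜ

/-- `V` is a connected component of the regular set. -/
def IsTile (l : ℂ) (V : Set ℂ) : Prop :=
  ∃ z ∈ regularSet l, V = connectedComponentIn (regularSet l) z

/-- The least `n ≥ 1` with `F^n(V) = V` (and `0` if there is none). -/
noncomputable def tilePeriod (l : ℂ) (V : Set ℂ) : ℕ :=
  Function.minimalPeriod (Set.image (pwRot l)) V

/-- On the set `V` the map `f` coincides with a rotation about `c` of order exactly `k`
(of order `1` when it is the identity). -/
def IsRotationOn (f : ℂ → ℂ) (V : Set ℂ) (c : ℂ) (k : ℕ) : Prop :=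
  0 < k ∧ ∃ m : ℂ, IsPrimitiveRoot m k ∧ ∀ z ∈ V, f z = c + m * (z - c)

/-! Write λ = exp(iπr/Q) with r prime to Q. In the rotating frame v_k = λ^(-k) z_k, F becomes a
sequence of unit shears along Q lines through 0, with opposite directions on the two sides of each
line (`shear_of_pwRot`). The lines cut the plane into 2Q sectors. Far out in a sector all shears
keep their sign, and Q consecutive steps use each line once and add up to `turn Q`; distant paths
thus circulate from sector to sector.

The heart is that orbits avoiding the real line are bounded. Rotating back by one sector after each
crossing gives a return map to a strip. Arbitrarily far out there are points z that the passage
through a sector merely turns by π/Q (`exists_center`). Seen from such a z, the return map is the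
rotation by -π/Q followed by an integer multiple of (1, κ), so the regular 2Q-gon of side 1 about z
is a bead of a necklace, and a path beyond the bead stays beyond it (`InSection.step`). Hence what
starts far away stays far away (`exists_far`), and time reversal turns this into boundedness
(`orbit_bounded`).

The rest is soft. Iterates restricted to a tile are isometries with linear part λ^n, and tiles are
convex (`IsTile.convex`). Bounded orbits force bounded tiles (`IsTile.isBounded`) and recurrence
(`IsTile.exists_return`); a translation of a bounded tile into itself is trivial
(`IsTile.iterate_eq_self`); the barycenter of a return orbit is the center (`IsTile.exists_fixed`).
Remote bead centers keep away from the real line and have long periods, so ℓ is unbounded. For λ =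
i, two explicit tiles have orders 2 and 4. -/

/-- The `2Q`-th root of unity `exp(i j π / Q)`. -/
noncomputable def rt (Q : ℕ) (j : ℤ) : ℂ :=
  Complex.exp (((j * (Real.pi / Q) : ℝ) : ℂ) * I)

/-- The slope constant `cot(π / 2Q)`. -/
noncomputable def kap (Q : ℕ) : ℝ :=
  (1 + Real.cos (Real.pi / Q)) / Real.sin (Real.pi / Q)

/-! ### Roots of unity, heights over lines, and sectors -/

section Roots

variable {Q : ℕ}

lemma rt_re (j : ℤ) : (rt Q j).re = Real.cos (j * (Real.pi / Q)) :=
  Complex.exp_ofReal_mul_I_re _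

lemma rt_im (j : ℤ) : (rt Q j).im = Real.sin (j * (Real.pi / Q)) :=
  Complex.exp_ofReal_mul_I_im _

lemma rt_add (i j : ℤ) : rt Q (i + j) = rt Q i * rt Q j := by
  unfold rt
  rw [← Complex.exp_add]
  congr 1
  push_cast
  ring

@[simp] lemma rt_zero : rt Q 0 = 1 := by simp [rt]

lemma rt_pow (j : ℤ) (k : ℕ) : rt Q j ^ k = rt Q (j * k) := by
  unfold rt
  rw [← Complex.exp_nat_mul]
  congr 1
  push_cast
  ring

lemma norm_rt (j : ℤ) : ‖rt Q j‖ = 1 := Complex.norm_exp_ofReal_mul_I _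

lemma rt_neg_mul (j : ℤ) : rt Q (-j) * rt Q j = 1 := by
  rw [← rt_add]; simp

lemma rt_mul_neg (j : ℤ) : rt Q j * rt Q (-j) = 1 := by
  rw [← rt_add]; simp

lemma conj_rt (j : ℤ) : (starRingEnd ℂ) (rt Q j) = rt Q (-j) := by
  unfold rt
  rw [← Complex.exp_conj]
  congr 1
  simp

lemma rt_period (hQ : 2 ≤ Q) : rt Q (Q : ℤ) = -1 := by
  have h : (Q : ℝ) ≠ 0 := by positivity
  unfold rt
  rw [← Complex.exp_pi_mul_I]
  congr 3
  push_cast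
  field_simp

lemma rt_add_period (hQ : 2 ≤ Q) (j : ℤ) : rt Q (j + Q) = -rt Q j := by
  rw [rt_add, rt_period hQ]; ring

lemma angle_pos (hQ : 2 ≤ Q) : 0 < Real.pi / Q := by
  have : 0 < (Q : ℝ) := by positivity
  positivity

lemma angle_le (hQ : 2 ≤ Q) : Real.pi / Q ≤ Real.pi / 2 := by
  have : (2 : ℝ) ≤ Q := by exact_mod_cast hQ
  exact div_le_div_of_nonneg_left Real.pi_pos.le (by norm_num) this

lemma mul_angle (hQ : 2 ≤ Q) : (Q : ℝ) * (Real.pi / Q) = Real.pi := by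
  have : (Q : ℝ) ≠ 0 := by positivity
  field_simp

lemma sin_angle_pos (hQ : 2 ≤ Q) : 0 < Real.sin (Real.pi / Q) :=
  Real.sin_pos_of_pos_of_lt_pi (angle_pos hQ) (by linarith [angle_le hQ, Real.pi_pos])

lemma cos_angle_nonneg (hQ : 2 ≤ Q) : 0 ≤ Real.cos (Real.pi / Q) :=
  Real.cos_nonneg_of_neg_pi_div_two_le_of_le (by linarith [angle_pos hQ, Real.pi_pos]) (angle_le hQ)

lemma kap_mul_sin (hQ : 2 ≤ Q) :
    kap Q * Real.sin (Real.pi / Q) = 1 + Real.cos (Real.pi / Q) :=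
  div_mul_cancel₀ _ (sin_angle_pos hQ).ne'

lemma kap_pos (hQ : 2 ≤ Q) : 0 < kap Q :=
  div_pos (by linarith [cos_angle_nonneg hQ]) (sin_angle_pos hQ)

lemma kap_mul_one_sub_cos (hQ : 2 ≤ Q) :
    kap Q * (1 - Real.cos (Real.pi / Q)) = Real.sin (Real.pi / Q) := by
  have h := sin_angle_pos hQ
  unfold kap
  field_simp
  nlinarith [Real.sin_sq_add_cos_sq (Real.pi / Q)]

lemma cos_angle_lt_one (hQ : 2 ≤ Q) : Real.cos (Real.pi / Q) < 1 := by
  nlinarith [Real.sin_sq_add_cos_sq (Real.pi / Q), sin_angle_pos hQ, cos_angle_nonneg hQ]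

lemma sin_mul_angle_nonneg (hQ : 2 ≤ Q) {j : ℤ} (h0 : 0 ≤ j) (h1 : j ≤ Q) :
    0 ≤ Real.sin (j * (Real.pi / Q)) := by
  have h0' : (0 : ℝ) ≤ j := by exact_mod_cast h0
  have h1' : (j : ℝ) ≤ Q := by exact_mod_cast h1
  apply Real.sin_nonneg_of_nonneg_of_le_pi (mul_nonneg h0' (angle_pos hQ).le)
  calc (j : ℝ) * (Real.pi / Q) ≤ Q * (Real.pi / Q) :=
        mul_le_mul_of_nonneg_right h1' (angle_pos hQ).le
    _ = Real.pi := mul_angle hQ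

lemma sin_angle_le_sin_mul (hQ : 2 ≤ Q) {j : ℤ} (h0 : 1 ≤ j) (h1 : j + 1 ≤ Q) :
    Real.sin (Real.pi / Q) ≤ Real.sin (j * (Real.pi / Q)) := by
  have h0' : (1 : ℝ) ≤ j := by exact_mod_cast h0
  have h1' : (j : ℝ) + 1 ≤ Q := by exact_mod_cast h1
  have ha := angle_pos hQ
  have hp := mul_angle hQ
  rcases le_total (j * (Real.pi / Q)) (Real.pi / 2) with h | h
  · exact Real.sin_le_sin_of_le_of_le_pi_div_two (by linarith [Real.pi_pos]) h (by nlinarith)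
  · rw [← Real.sin_pi_sub (j * (Real.pi / Q))]
    exact Real.sin_le_sin_of_le_of_le_pi_div_two (by linarith [Real.pi_pos]) (by linarith)
      (by nlinarith)

lemma rt_mul_im (j : ℤ) (v : ℂ) : (rt Q j * v).im =
    v.re * Real.sin (j * (Real.pi / Q)) + v.im * Real.cos (j * (Real.pi / Q)) := by
  rw [Complex.mul_im, rt_re, rt_im]; ring

lemma rt_mul_re (j : ℤ) (v : ℂ) : (rt Q j * v).re =
    v.re * Real.cos (j * (Real.pi / Q)) - v.im * Real.sin (j * (Real.pi / Q)) := by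
  rw [Complex.mul_re, rt_re, rt_im]; ring

lemma rt_neg_one_mul_im (v : ℂ) : (rt Q (-1) * v).im =
    v.im * Real.cos (Real.pi / Q) - v.re * Real.sin (Real.pi / Q) := by
  rw [rt_mul_im]
  simp [Real.sin_neg, Real.cos_neg]
  ring

lemma rt_neg_one_mul_re (v : ℂ) : (rt Q (-1) * v).re =
    v.re * Real.cos (Real.pi / Q) + v.im * Real.sin (Real.pi / Q) := by
  rw [rt_mul_re]
  simp [Real.sin_neg, Real.cos_neg]

lemma rt_one_mul_im (v : ℂ) : (rt Q 1 * v).im =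
    v.re * Real.sin (Real.pi / Q) + v.im * Real.cos (Real.pi / Q) := by
  rw [rt_mul_im]
  simp

/-- Heights over an arbitrary line in terms of the heights over two consecutive lines. -/
lemma sin_mul_height (j : ℤ) (v : ℂ) :
    Real.sin (Real.pi / Q) * (rt Q j * v).im =
      -(rt Q (-1) * v).im * Real.sin (j * (Real.pi / Q)) +
        v.im * Real.sin ((j + 1 : ℤ) * (Real.pi / Q)) := by
  rw [rt_mul_im, rt_neg_one_mul_im]
  push_cast
  rw [add_mul, one_mul, Real.sin_add]
  ring

/-- After squaring and doubling the angle this says cos(mπ/Q) ≤ cos(π/Q), true because an odd m is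
never a multiple of 2Q. -/
lemma abs_cos_odd_le (hQ : 2 ≤ Q) {m : ℤ} (hm : Odd m) :
    |Real.cos (m * (Real.pi / Q / 2))| ≤ Real.cos (Real.pi / Q / 2) := by
  have ha := angle_pos hQ
  have hl := angle_le hQ
  have hc : 0 ≤ Real.cos (Real.pi / Q / 2) :=
    Real.cos_nonneg_of_neg_pi_div_two_le_of_le (by linarith) (by linarith)
  apply abs_le_of_sq_le_sq _ hc
  rw [Real.cos_sq, Real.cos_sq (Real.pi / Q / 2)]
  suffices h : Real.cos (m * (Real.pi / Q)) ≤ Real.cos (Real.pi / Q) by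
    have e1 : 2 * (m * (Real.pi / Q / 2)) = m * (Real.pi / Q) := by ring
    have e2 : 2 * (Real.pi / Q / 2) = Real.pi / Q := by ring
    rw [e1, e2]; linarith
  have hQz : (0 : ℤ) < 2 * Q := by omega
  set t := m % (2 * Q) with ht
  set u := m / (2 * Q) with hu
  have hmt : m = t + 2 * Q * u := by rw [ht, hu]; exact (Int.emod_add_mul_ediv _ _).symm
  have ht0 := Int.emod_nonneg m hQz.ne'
  have ht1 := Int.emod_lt_of_pos m hQz
  have htodd : Odd t := by
    rcases hm with ⟨x, hx⟩
    exact ⟨x - Q * u, by linarith⟩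
  have hcos : Real.cos (m * (Real.pi / Q)) = Real.cos (t * (Real.pi / Q)) := by
    have : (m : ℝ) * (Real.pi / Q) = t * (Real.pi / Q) + u * (2 * Real.pi) := by
      rw [hmt]; push_cast
      linear_combination (2 * (u : ℝ)) * mul_angle hQ
    rw [this, Real.cos_add_int_mul_two_pi]
  rw [hcos]
  have ht1' : 1 ≤ t := by rcases htodd with ⟨x, hx⟩; omega
  have ht2' : t ≤ 2 * Q - 1 := by omega
  have r1 : (1 : ℝ) ≤ t := by exact_mod_cast ht1'
  have r2 : (t : ℝ) ≤ 2 * Q - 1 := by exact_mod_cast ht2'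
  have hp := mul_angle hQ
  rcases le_total (t * (Real.pi / Q)) Real.pi with h | h
  · exact Real.cos_le_cos_of_nonneg_of_le_pi ha.le h (by nlinarith)
  · rw [← Real.cos_two_pi_sub]
    exact Real.cos_le_cos_of_nonneg_of_le_pi ha.le (by linarith) (by nlinarith)

/-- The rectangle `|Re| < 1/2`, `|Im| < κ/2` lies inside the regular `2Q`-gon of side `1`. -/
lemma height_lt_of_rectangle (hQ : 2 ≤ Q) {w : ℂ} (hre : |w.re| < 1 / 2)
    (him : |w.im| < kap Q / 2) (j : ℤ) : (rt Q j * w).im < kap Q / 2 := by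
  set a := Real.pi / Q / 2 with ha
  have hpa := angle_pos hQ
  have hla := angle_le hQ
  have hsa : 0 < Real.sin a := Real.sin_pos_of_pos_of_lt_pi (by linarith) (by linarith)
  have e : Real.pi / Q = 2 * a := by rw [ha]; ring
  have hk : kap Q * Real.sin a = Real.cos a := by
    have := kap_mul_one_sub_cos hQ
    rw [e, Real.cos_two_mul, Real.sin_two_mul] at this
    have h2 := Real.sin_sq_add_cos_sq a
    have : kap Q * Real.sin a * (2 * Real.sin a) = Real.cos a * (2 * Real.sin a) := by
      linear_combination this + 2 * kap Q * h2
    exact mul_right_cancel₀ (by positivity) this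
  have hodd1 : Odd (2 * j + 1) := ⟨j, rfl⟩
  have hodd2 : Odd (2 * j - 1) := ⟨j - 1, by ring⟩
  have c1 := abs_le.1 (abs_cos_odd_le hQ hodd1)
  have c2 := abs_le.1 (abs_cos_odd_le hQ hodd2)
  have e1 : ((2 * j + 1 : ℤ) : ℝ) * (Real.pi / Q / 2) = j * (Real.pi / Q) + a := by
    rw [ha]; push_cast; ring
  have e2 : ((2 * j - 1 : ℤ) : ℝ) * (Real.pi / Q / 2) = j * (Real.pi / Q) - a := by
    rw [ha]; push_cast; ring
  rw [e1, Real.cos_add] at c1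
  rw [e2, Real.cos_sub] at c2
  rw [rt_mul_im]
  set s := Real.sin (j * (Real.pi / Q))
  set c := Real.cos (j * (Real.pi / Q))
  have hsc : s ^ 2 + c ^ 2 = 1 := Real.sin_sq_add_cos_sq _
  have hmain : Real.cos a * |c| + Real.sin a * |s| ≤ Real.cos a := by
    rcases abs_cases c with ⟨h, _⟩ | ⟨h, _⟩ <;> rcases abs_cases s with ⟨h', _⟩ | ⟨h', _⟩ <;>
      rw [h, h'] <;> linarith [c1.1, c1.2, c2.1, c2.2]
  have hkp := kap_pos hQ
  -- Half the left side is the support function of the rectangle in the direction at hand.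
  -- Strictness comes afterwards from whichever of s, c is nonzero.
  have hb : |s| + kap Q * |c| ≤ kap Q := by
    have : Real.sin a * (|s| + kap Q * |c|) ≤ Real.sin a * kap Q := by
      linear_combination hmain + (|c| - 1) * hk
    exact le_of_mul_le_mul_left this hsa
  have h1 : w.re * s ≤ |w.re| * |s| := by rw [← abs_mul]; exact le_abs_self _
  have h2 : w.im * c ≤ |w.im| * |c| := by rw [← abs_mul]; exact le_abs_self _
  have hs0 := abs_nonneg s
  have hc0 := abs_nonneg c
  rcases eq_or_ne s 0 with h | h
  · have hc : 0 < |c| := by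
      apply abs_pos.2; intro hc; rw [h, hc] at hsc; norm_num at hsc
    nlinarith
  · have hs : 0 < |s| := abs_pos.2 h
    nlinarith

/-- Points of the plane in terms of the heights over two consecutive lines. -/
lemma sin_mul_eq (v : ℂ) :
    (Real.sin (Real.pi / Q) : ℂ) * v =
      ((-(rt Q (-1) * v).im : ℝ) : ℂ) + (v.im : ℂ) * rt Q 1 := by
  apply Complex.ext
  · rw [Complex.add_re, Complex.re_ofReal_mul, Complex.re_ofReal_mul, Complex.ofReal_re, rt_re,
      rt_neg_one_mul_im]
    push_cast
    rw [one_mul]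
    ring
  · rw [Complex.add_im, Complex.im_ofReal_mul, Complex.im_ofReal_mul, Complex.ofReal_im, rt_im]
    push_cast
    rw [one_mul]
    ring

/-- In the base sector, v is a nonnegative combination of the two boundary directions, with the two
heights as coefficients. With `sub_height_le`, the difference of the heights is comparable to the
norm. -/
lemma norm_mul_sin_le (hQ : 2 ≤ Q) {v : ℂ} (hb : 0 ≤ v.im) (he : (rt Q (-1) * v).im ≤ 0) :
    Real.sin (Real.pi / Q) * ‖v‖ ≤ v.im - (rt Q (-1) * v).im := by
  have h := congrArg norm (sin_mul_eq (Q := Q) v)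
  rw [norm_mul, Complex.norm_real, Real.norm_of_nonneg (sin_angle_pos hQ).le] at h
  rw [h]
  refine (norm_add_le _ _).trans ?_
  rw [norm_mul, norm_rt, Complex.norm_real, Complex.norm_real, Real.norm_of_nonneg hb,
    Real.norm_of_nonneg (by linarith)]
  linarith

lemma sub_height_le (v : ℂ) : v.im - (rt Q (-1) * v).im ≤ 2 * ‖v‖ := by
  have h1 := (abs_le.1 (Complex.abs_im_le_norm v)).2
  have h2 := (abs_le.1 (Complex.abs_im_le_norm (rt Q (-1) * v))).1
  rw [norm_mul, norm_rt] at h2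
  linarith

/-- Every nonzero point lies in one of the `2Q` sectors. -/
lemma exists_sector (hQ : 2 ≤ Q) {v : ℂ} (hv : v ≠ 0) :
    ∃ J : ℤ, 0 ≤ (rt Q (-J) * v).im ∧ (rt Q (-1) * (rt Q (-J) * v)).im < 0 := by
  by_contra! hcon
  have hper : ∀ J : ℤ, (rt Q (-(J + Q)) * v).im = -(rt Q (-J) * v).im := by
    intro J
    have : rt Q (-(J + Q)) = -rt Q (-J) := by
      rw [← neg_eq_iff_eq_neg, ← rt_add_period hQ]; congr 1; ring
    rw [this]; simp
  -- Without a sector, nonnegativity passes from J to J + 1 for ever. A half turn flips signs, so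
  -- two consecutive heights vanish and v = 0.
  have hstep : ∀ J : ℤ, 0 ≤ (rt Q (-J) * v).im → 0 ≤ (rt Q (-(J + 1)) * v).im := by
    intro J hJ
    have := hcon J hJ
    rwa [← mul_assoc, ← rt_add, show -1 + -J = -(J + 1) by ring] at this
  obtain ⟨J, hJ⟩ : ∃ J : ℤ, 0 ≤ (rt Q (-J) * v).im := by
    by_cases h : 0 ≤ (rt Q (-0) * v).im
    · exact ⟨0, h⟩
    · refine ⟨0 + Q, ?_⟩
      rw [hper]; linarith
  have hall : ∀ k : ℕ, 0 ≤ (rt Q (-(J + k)) * v).im := by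
    intro k
    induction k with
    | zero => simpa using hJ
    | succ k ih => have := hstep _ ih; push_cast; rwa [← add_assoc]
  have h0 : (rt Q (-J) * v).im = 0 := by
    have := hall Q
    rw [hper] at this; linarith
  have h1 : (rt Q (-1) * (rt Q (-J) * v)).im = 0 := by
    have a := hall 1
    have b := hall (1 + Q)
    push_cast at a b
    rw [← add_assoc, hper] at b
    rw [← mul_assoc, ← rt_add, show -1 + -J = -(J + 1) by ring]; linarith
  have := norm_mul_sin_le hQ h0.ge h1.le
  rw [h0, h1, norm_mul, norm_rt, one_mul] at this
  have := mul_pos (sin_angle_pos hQ) (norm_pos_iff.2 hv)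
  linarith

end Roots

/-! ### Shears in the rotating frame and their drift -/

/-- The shear along the line spanned by `rt Q (-j)`: a unit step whose direction depends on the
side of the line. -/
def Shear (Q : ℕ) (j : ℤ) (v v' : ℂ) : Prop :=
  ∃ s : ℝ, (s = 1 ∨ s = -1) ∧ 0 ≤ s * (rt Q j * v).im ∧ v' = v - s * rt Q (-j)

/-- Sequences of shears with directions `r k + c`, none of whose points lies on
the line of its shear. -/
def IsShearPath (Q : ℕ) (r c : ℤ) (n : ℕ) (v : ℕ → ℂ) : Prop :=
  ∀ k : ℕ, k < n → Shear Q (r * k + c) (v k) (v (k + 1)) ∧ (rt Q (r * k + c) * v k).im ≠ 0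

/-- The step of the shear of direction `m`, seen from the sector `0 ≤ arg < π / Q`. -/
noncomputable def drift (Q : ℕ) (m : ℤ) : ℂ := -rt Q (-(m % Q))

/-- The sum of the first `k` steps. -/
noncomputable def driftSum (Q : ℕ) (r c : ℤ) (k : ℕ) : ℂ :=
  ∑ i ∈ Finset.range k, drift Q (r * i + c)

/-- The sum of the steps over a full period. -/
noncomputable def turn (Q : ℕ) : ℂ := ⟨-1, kap Q⟩

section Shears

variable {Q : ℕ}

/-- Turning the line by π reverses its direction and swaps its sides; replacing s by -s compensates
for both. -/
lemma Shear.add_period (hQ : 2 ≤ Q) {j : ℤ} {v v' : ℂ} (h : Shear Q j v v') :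
    Shear Q (j + Q) v v' := by
  obtain ⟨s, hs, h0, h1⟩ := h
  refine ⟨-s, by rcases hs with rfl | rfl <;> norm_num, ?_, ?_⟩
  · rw [rt_add_period hQ, neg_mul (rt Q j), Complex.neg_im, neg_mul_neg]; exact h0
  · rw [h1, show -j = -(j + Q) + Q by ring, rt_add_period hQ]; push_cast; ring

lemma Shear.sub_period (hQ : 2 ≤ Q) {j : ℤ} {v v' : ℂ} (h : Shear Q (j + Q) v v') :
    Shear Q j v v' := by
  obtain ⟨s, hs, h0, h1⟩ := h
  refine ⟨-s, by rcases hs with rfl | rfl <;> norm_num, ?_, ?_⟩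
  · rw [rt_add_period hQ, neg_mul, Complex.neg_im, mul_neg] at h0
    rwa [neg_mul]
  · rw [h1, show -j = -(j + Q) + Q by ring, rt_add_period hQ]; push_cast; ring

lemma Shear.add_mul_period (hQ : 2 ≤ Q) {j : ℤ} {v v' : ℂ} (h : Shear Q j v v') (k : ℤ) :
    Shear Q (j + Q * k) v v' := by
  induction k using Int.induction_on with
  | zero => simpa using h
  | succ k ih =>
    have := ih.add_period hQ
    rwa [show j + Q * (k : ℤ) + Q = j + Q * (k + 1) by ring] at this
  | pred k ih =>
    apply Shear.sub_period hQ
    rwa [show j + Q * (-(k : ℤ) - 1) + Q = j + Q * (-k) by ring]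

lemma Shear.congr (hQ : 2 ≤ Q) {i j : ℤ} {v v' : ℂ} (h : Shear Q i v v')
    (hij : i % Q = j % Q) : Shear Q j v v' := by
  obtain ⟨k, hk⟩ := Int.dvd_of_emod_eq_zero (Int.emod_eq_emod_iff_emod_sub_eq_zero.1 hij.symm)
  have := h.add_mul_period hQ k
  rwa [← hk, add_sub_cancel] at this

lemma rt_eq_or_neg (hQ : 2 ≤ Q) {i j : ℤ} (hij : i % Q = j % Q) :
    rt Q j = rt Q i ∨ rt Q j = -rt Q i := by
  obtain ⟨k, hk⟩ := Int.dvd_of_emod_eq_zero (Int.emod_eq_emod_iff_emod_sub_eq_zero.1 hij.symm)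
  have : rt Q j = rt Q i * rt Q (Q * k) := by rw [← rt_add, ← hk]; congr 1; ring
  rw [this]
  clear this hk
  have hk : rt Q (Q * k) = 1 ∨ rt Q (Q * k) = -1 := by
    induction k using Int.induction_on with
    | zero => simp
    | succ k ih =>
      rw [mul_add, mul_one, rt_add_period hQ]
      rcases ih with h | h <;> simp [h]
    | pred k ih =>
      have e : rt Q (Q * (-(k : ℤ) - 1)) = -rt Q (Q * -(k : ℤ)) := by
        rw [← neg_eq_iff_eq_neg, ← rt_add_period hQ]; congr 1; ring
      rw [e]
      rcases ih with h | h <;> rw [h] <;> simp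
  rcases hk with h | h <;> simp [h]

lemma height_ne_zero_congr (hQ : 2 ≤ Q) {i j : ℤ} (hij : i % Q = j % Q) {v : ℂ}
    (h : (rt Q i * v).im ≠ 0) : (rt Q j * v).im ≠ 0 := by
  rcases rt_eq_or_neg hQ hij with e | e <;> rw [e]
  · exact h
  · rw [neg_mul, Complex.neg_im]; exact neg_ne_zero.2 h

lemma abs_height_congr (hQ : 2 ≤ Q) {i j : ℤ} (hij : i % Q = j % Q) (v : ℂ) :
    |(rt Q i * v).im| = |(rt Q j * v).im| := by
  rcases rt_eq_or_neg hQ hij with e | e <;> rw [e]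
  rw [neg_mul, Complex.neg_im, abs_neg]

/-- Rotating the plane only shifts the phase, so a path that has entered another sector can be
brought back to the base sector. -/
lemma Shear.rotate {i j : ℤ} {v v' : ℂ} (h : Shear Q j v v') :
    Shear Q (j + i) (rt Q (-i) * v) (rt Q (-i) * v') := by
  obtain ⟨s, hs, h0, h1⟩ := h
  refine ⟨s, hs, ?_, ?_⟩
  · rw [← mul_assoc, ← rt_add, add_neg_cancel_right]; exact h0
  · rw [h1, neg_add, add_comm (-j), rt_add]; ring

lemma IsShearPath.rotate {r c i : ℤ} {n : ℕ} {v : ℕ → ℂ} (h : IsShearPath Q r c n v) :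
    IsShearPath Q r (c + i) n (fun k => rt Q (-i) * v k) := by
  intro k hk
  refine ⟨by rw [← add_assoc]; exact (h k hk).1.rotate, ?_⟩
  rw [← mul_assoc, ← rt_add, ← add_assoc, add_neg_cancel_right]
  exact (h k hk).2

lemma IsShearPath.shift {r c : ℤ} {n N : ℕ} {v : ℕ → ℂ} (h : IsShearPath Q r c n v)
    (hN : N ≤ n) : IsShearPath Q r (r * N + c) (n - N) (fun k => v (N + k)) := by
  intro k hk
  have := h (N + k) (by omega)
  rwa [show r * ((N + k : ℕ) : ℤ) + c = r * k + (r * N + c) by push_cast; ring] at this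

lemma IsShearPath.congr (hQ : 2 ≤ Q) {r c c' : ℤ} {n : ℕ} {v : ℕ → ℂ}
    (h : IsShearPath Q r c n v) (hc : c % Q = c' % Q) : IsShearPath Q r c' n v := by
  intro k hk
  have e : (r * k + c) % Q = (r * k + c') % Q := Int.ModEq.add_left _ hc
  exact ⟨(h k hk).1.congr hQ e, height_ne_zero_congr hQ e (h k hk).2⟩

lemma drift_congr {i j : ℤ} (h : i % Q = j % Q) : drift Q i = drift Q j := by
  unfold drift; rw [h]

lemma driftSum_zero (r c : ℤ) : driftSum Q r c 0 = 0 := by simp [driftSum]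

lemma driftSum_succ (r c : ℤ) (k : ℕ) :
    driftSum Q r c (k + 1) = driftSum Q r c k + drift Q (r * k + c) :=
  Finset.sum_range_succ _ _

/-- As r is invertible modulo Q, any Q consecutive steps use each line exactly once. -/
lemma image_phase (hQ : 2 ≤ Q) {r : ℤ} (hr : IsCoprime r Q) (c : ℤ) :
    (Finset.range Q).image (fun i : ℕ => ((r * i + c) % Q).toNat) = Finset.range Q ∧
      Set.InjOn (fun i : ℕ => ((r * i + c) % Q).toNat) (Finset.range Q) := by
  have hQ0 : (0 : ℤ) < Q := by omega
  have hinj : Set.InjOn (fun i : ℕ => ((r * i + c) % Q).toNat) (Finset.range Q) := by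
    intro i hi j hj hij
    have h1 := Int.emod_nonneg (r * i + c) hQ0.ne'
    have h2 := Int.emod_nonneg (r * j + c) hQ0.ne'
    have h3 : (r * i + c) % Q = (r * j + c) % Q := by
      simp only at hij; omega
    have h4 : (Q : ℤ) ∣ r * (i - j) := by
      have := Int.dvd_of_emod_eq_zero (Int.emod_eq_emod_iff_emod_sub_eq_zero.1 h3)
      rwa [show r * i + c - (r * j + c) = r * ((i : ℤ) - j) by ring] at this
    have h5 : (Q : ℤ) ∣ (i : ℤ) - j := hr.symm.dvd_of_dvd_mul_left h4
    have hi' := Finset.mem_range.1 hi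
    have hj' := Finset.mem_range.1 hj
    have h6 := Int.eq_zero_of_abs_lt_dvd h5 (by rw [abs_lt]; omega)
    omega
  refine ⟨?_, hinj⟩
  apply Finset.eq_of_subset_of_card_le
  · intro x hx
    obtain ⟨i, _, rfl⟩ := Finset.mem_image.1 hx
    have h1 := Int.emod_nonneg (r * i + c) hQ0.ne'
    have h2 := Int.emod_lt_of_pos (r * i + c) hQ0
    rw [Finset.mem_range]; omega
  · rw [Finset.card_image_of_injOn hinj]

/-- Every phase occurs among the first `Q` times. -/
lemma exists_phase (hQ : 2 ≤ Q) {r : ℤ} (hr : IsCoprime r Q) (c : ℤ) {j : ℤ} (h0 : 0 ≤ j)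
    (h1 : j < Q) : ∃ i : ℕ, i < Q ∧ (r * i + c) % Q = j := by
  have h := (image_phase hQ hr c).1
  have hj : j.toNat ∈ Finset.range Q := by rw [Finset.mem_range]; omega
  rw [← h] at hj
  obtain ⟨i, hi, e⟩ := Finset.mem_image.1 hj
  have := Int.emod_nonneg (r * i + c) (show (Q : ℤ) ≠ 0 by omega)
  exact ⟨i, Finset.mem_range.1 hi, by omega⟩

lemma one_sub_rt_mul_turn (hQ : 2 ≤ Q) : (1 - rt Q (-1)) * turn Q = -2 := by
  have h1 := kap_mul_sin hQ
  have h2 := kap_mul_one_sub_cos hQ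
  apply Complex.ext
  · simp [Complex.mul_re, rt_re, rt_im, turn]
    linarith
  · simp [Complex.mul_im, rt_re, rt_im, turn]
    linarith

lemma one_sub_rt_neg_one_ne_zero (hQ : 2 ≤ Q) : 1 - rt Q (-1) ≠ 0 := by
  intro h
  have := one_sub_rt_mul_turn hQ
  rw [h] at this
  norm_num at this

/-- Up to order this is a geometric series with ratio `rt Q (-1)`, whose Q-th power is -1. -/
lemma driftSum_period (hQ : 2 ≤ Q) {r : ℤ} (hr : IsCoprime r Q) (c : ℤ) :
    driftSum Q r c Q = turn Q := by
  have h := image_phase hQ hr c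
  have e : driftSum Q r c Q = ∑ j ∈ Finset.range Q, -rt Q (-(j : ℤ)) := by
    conv_rhs => rw [← h.1]
    rw [Finset.sum_image h.2]
    apply Finset.sum_congr rfl
    intro i _
    have := Int.emod_nonneg (r * i + c) (show (Q : ℤ) ≠ 0 by omega)
    unfold drift
    rw [Int.toNat_of_nonneg this]
  have e2 : (1 - rt Q (-1)) * driftSum Q r c Q = -2 := by
    rw [e, Finset.mul_sum]
    have : ∀ j ∈ Finset.range Q, (1 - rt Q (-1)) * -rt Q (-(j : ℤ)) =
        rt Q (-((j + 1 : ℕ) : ℤ)) - rt Q (-(j : ℤ)) := by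
      intro j _
      rw [show -((j + 1 : ℕ) : ℤ) = -1 + -(j : ℤ) by push_cast; ring, rt_add]
      ring
    rw [Finset.sum_congr rfl this, Finset.sum_range_sub (fun j : ℕ => rt Q (-(j : ℤ)))]
    have hp : rt Q (-(Q : ℤ)) = -1 := by
      rw [← conj_rt, rt_period hQ]; simp
    rw [hp]; norm_num
  exact mul_left_cancel₀ (one_sub_rt_neg_one_ne_zero hQ) (e2.trans (one_sub_rt_mul_turn hQ).symm)

lemma driftSum_add (r c : ℤ) (k l : ℕ) :
    driftSum Q r c (k + l) = driftSum Q r c k + driftSum Q r (r * k + c) l := by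
  unfold driftSum
  rw [Finset.sum_range_add]
  congr 1
  apply Finset.sum_congr rfl
  intro i _
  congr 1
  push_cast
  ring

lemma driftSum_congr {r c c' : ℤ} (h : c % Q = c' % Q) (k : ℕ) :
    driftSum Q r c k = driftSum Q r c' k :=
  Finset.sum_congr rfl fun _ _ => drift_congr (Int.ModEq.add_left _ h)

lemma driftSum_add_mul_period (hQ : 2 ≤ Q) {r : ℤ} (hr : IsCoprime r Q) (c : ℤ) (k i : ℕ) :
    driftSum Q r c (k + Q * i) = driftSum Q r c k + i * turn Q := by
  induction i with
  | zero => simp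
  | succ i ih =>
    rw [mul_add, mul_one, ← add_assoc, driftSum_add, driftSum_period hQ hr, ih]
    push_cast
    ring

/-- Together with `drift_rotate_im_mem`: no drift step lowers the height over either boundary line
of the base sector, so the drift can leave the sector only across the line `rt Q 1`. -/
lemma drift_im_mem (hQ : 2 ≤ Q) (m : ℤ) : 0 ≤ (drift Q m).im ∧ (drift Q m).im ≤ 1 := by
  have hQ0 : (0 : ℤ) < Q := by omega
  have h := sin_mul_angle_nonneg hQ (Int.emod_nonneg m hQ0.ne') (Int.emod_lt_of_pos m hQ0).le
  have e : (drift Q m).im = Real.sin ((m % Q : ℤ) * (Real.pi / Q)) := by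
    unfold drift
    rw [Complex.neg_im, rt_im]
    push_cast
    rw [neg_mul, Real.sin_neg, neg_neg]
  rw [e]
  exact ⟨h, Real.sin_le_one _⟩

lemma drift_rotate_im_mem (hQ : 2 ≤ Q) (m : ℤ) :
    0 ≤ (rt Q (-1) * drift Q m).im ∧ (rt Q (-1) * drift Q m).im ≤ 1 := by
  have hQ0 : (0 : ℤ) < Q := by omega
  have h := sin_mul_angle_nonneg hQ (j := m % Q + 1)
    (by linarith [Int.emod_nonneg m hQ0.ne']) (Int.emod_lt_of_pos m hQ0)
  have e : (rt Q (-1) * drift Q m).im = Real.sin ((m % Q + 1 : ℤ) * (Real.pi / Q)) := by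
    unfold drift
    rw [mul_neg, ← rt_add, Complex.neg_im, rt_im, show -1 + -(m % Q) = -(m % Q + 1) by ring]
    push_cast
    rw [neg_mul, Real.sin_neg, neg_neg]
  rw [e]
  exact ⟨h, Real.sin_le_one _⟩

lemma driftSum_im_mem (hQ : 2 ≤ Q) (r c : ℤ) (k : ℕ) :
    0 ≤ (driftSum Q r c k).im ∧ (driftSum Q r c k).im ≤ k := by
  induction k with
  | zero => simp [driftSum]
  | succ k ih =>
    have := drift_im_mem hQ (r * k + c)
    rw [driftSum_succ, Complex.add_im]
    push_cast
    constructor <;> linarith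

lemma driftSum_rotate_im_mem (hQ : 2 ≤ Q) (r c : ℤ) (k : ℕ) :
    0 ≤ (rt Q (-1) * driftSum Q r c k).im ∧ (rt Q (-1) * driftSum Q r c k).im ≤ k := by
  induction k with
  | zero => simp [driftSum]
  | succ k ih =>
    have := drift_rotate_im_mem hQ (r * k + c)
    rw [driftSum_succ, mul_add, Complex.add_im]
    push_cast
    constructor <;> linarith

lemma rt_neg_one_mul_turn (hQ : 2 ≤ Q) : rt Q (-1) * turn Q = ⟨1, kap Q⟩ := by
  have h := one_sub_rt_mul_turn hQ
  have : rt Q (-1) * turn Q = turn Q + 2 := by linear_combination -h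
  rw [this]
  apply Complex.ext <;> simp [turn]
  norm_num

/-- The difference of the two heights is almost conserved. -/
lemma driftSum_sub_height (hQ : 2 ≤ Q) {r : ℤ} (hr : IsCoprime r Q) (c : ℤ) (k : ℕ) :
    -(Q : ℝ) ≤ (driftSum Q r c k).im - (rt Q (-1) * driftSum Q r c k).im := by
  have e : k = k % Q + Q * (k / Q) := (Nat.mod_add_div k Q).symm
  set l := k % Q with hl
  have hlQ : (l : ℝ) ≤ Q := by
    exact_mod_cast (Nat.mod_lt k (by omega : 0 < Q)).le
  -- Full periods cancel, since `turn Q` raises both heights by κ; only the fewer than Q remaining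
  -- steps count.
  rw [e, driftSum_add_mul_period hQ hr, mul_add, mul_left_comm, rt_neg_one_mul_turn hQ,
    Complex.add_im, Complex.add_im, Complex.mul_im _ (turn Q), Complex.mul_im _ (⟨1, kap Q⟩ : ℂ)]
  have h1 := driftSum_im_mem hQ r c l
  have h2 := driftSum_rotate_im_mem hQ r c l
  simp only [turn, Complex.natCast_re, Complex.natCast_im, zero_mul, add_zero]
  linarith

/-! ### Passage through one sector -/

section Passage

variable {r c : ℤ} {v : ℂ} {k : ℕ}

/-- Before the line `rt Q 1` is crossed, heights over it are bounded. -/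
lemma height_le_of_not_crossed (hQ : 2 ≤ Q) (hr : IsCoprime r Q)
    (he : (rt Q (-1) * v).im ≤ 0)
    (h : ∀ i : ℕ, i < k → (r * i + c) % Q = Q - 1 → (rt Q (-1) * (v + driftSum Q r c i)).im ≤ 0) :
    (rt Q (-1) * (v + driftSum Q r c k)).im ≤ Q := by
  rcases lt_or_ge k Q with hk | hk
  · have := (driftSum_rotate_im_mem hQ r c k).2
    have hk' : (k : ℝ) ≤ Q := by exact_mod_cast hk.le
    rw [mul_add, Complex.add_im]
    linarith
  -- Some step among the last Q has phase Q - 1; there the height was at most 0, and each later step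
  -- adds at most 1.
  · obtain ⟨x, hx, hx'⟩ := exists_phase hQ hr (r * ((k - Q : ℕ) : ℤ) + c)
      (j := Q - 1) (by omega) (by omega)
    have h1 := h (k - Q + x) (by omega) (by
      rw [← hx']; push_cast; ring_nf)
    have h2 : k = (k - Q + x) + (Q - x) := by omega
    have h3 := (driftSum_rotate_im_mem hQ r (r * ((k - Q + x : ℕ) : ℤ) + c) (Q - x)).2
    have h4 : ((Q - x : ℕ) : ℝ) ≤ Q := by exact_mod_cast Nat.sub_le _ _
    rw [h2, driftSum_add, ← add_assoc, mul_add _ (v + _), Complex.add_im]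
    linarith

/-- By `sin_mul_height` the height over an inner line is a combination of the two boundary heights B
and -E, with coefficients at least 1. B is nonnegative, E is at most Q, and B - E is almost
conserved. -/
lemma height_ge_of_not_crossed (hQ : 2 ≤ Q) (hr : IsCoprime r Q) (hb : 0 ≤ v.im)
    (he : (rt Q (-1) * v).im ≤ 0)
    (h : ∀ i : ℕ, i < k → (r * i + c) % Q = Q - 1 → (rt Q (-1) * (v + driftSum Q r c i)).im ≤ 0)
    {j : ℤ} (hj1 : 1 ≤ j) (hj2 : j + 2 ≤ Q) :
    v.im - (rt Q (-1) * v).im - Q / Real.sin (Real.pi / Q) ≤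
      (rt Q j * (v + driftSum Q r c k)).im := by
  have hs := sin_angle_pos hQ
  have h1 := height_le_of_not_crossed hQ hr he h
  have h2 := driftSum_sub_height hQ hr c k
  have h3 := (driftSum_im_mem hQ r c k).1
  have key := sin_mul_height (Q := Q) j (v + driftSum Q r c k)
  have e1 : (v + driftSum Q r c k).im = v.im + (driftSum Q r c k).im := Complex.add_im _ _
  have e2 : (rt Q (-1) * (v + driftSum Q r c k)).im =
      (rt Q (-1) * v).im + (rt Q (-1) * driftSum Q r c k).im := by rw [mul_add, Complex.add_im]
  have s1 := sin_angle_le_sin_mul hQ hj1 (by linarith)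
  have s2 := sin_angle_le_sin_mul hQ (j := j + 1) (by linarith) (by linarith)
  have s3 := Real.sin_le_one (j * (Real.pi / Q))
  set σ := Real.sin (Real.pi / Q)
  set E := (rt Q (-1) * (v + driftSum Q r c k)).im
  set B := (v + driftSum Q r c k).im
  set y := (rt Q j * (v + driftSum Q r c k)).im
  set t1 := Real.sin (j * (Real.pi / Q))
  set t2 := Real.sin ((j + 1 : ℤ) * (Real.pi / Q))
  have hQ' : (0 : ℝ) ≤ Q := by positivity
  have a1 : 0 ≤ (Q - E) * (t1 - σ) := mul_nonneg (by linarith) (by linarith)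
  have a2 : 0 ≤ B * (t2 - σ) := mul_nonneg (by linarith) (by linarith)
  have a3 : 0 ≤ (Q : ℝ) * (1 - t1) := mul_nonneg hQ' (by linarith)
  have a4 : σ * (v.im - (rt Q (-1) * v).im) ≤ σ * (B - E + Q) :=
    mul_le_mul_of_nonneg_left (by linarith) hs.le
  have a5 : σ * (v.im - (rt Q (-1) * v).im - Q / σ) ≤ σ * y := by
    have : σ * (Q / σ) = Q := by field_simp
    rw [mul_sub, this]
    nlinarith
  exact le_of_mul_le_mul_left a5 hs

/-- Before the line `rt Q 1` is crossed, the point is on the positive side of every line. -/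
lemma height_nonneg_of_not_crossed (hQ : 2 ≤ Q) (hr : IsCoprime r Q) (hb : 0 ≤ v.im)
    (he : (rt Q (-1) * v).im ≤ 0)
    (hfar : Q / Real.sin (Real.pi / Q) ≤ v.im - (rt Q (-1) * v).im)
    (h : ∀ i : ℕ, i ≤ k → (r * i + c) % Q = Q - 1 → (rt Q (-1) * (v + driftSum Q r c i)).im ≤ 0) :
    0 ≤ (rt Q ((r * k + c) % Q) * (v + driftSum Q r c k)).im := by
  have hQ0 : (0 : ℤ) < Q := by omega
  have h0 := Int.emod_nonneg (r * k + c) hQ0.ne'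
  have h1 := Int.emod_lt_of_pos (r * k + c) hQ0
  set j := (r * k + c) % Q with hj
  rcases eq_or_ne j 0 with hj0 | hj0
  · rw [hj0, rt_zero, one_mul, Complex.add_im]
    linarith [(driftSum_im_mem hQ r c k).1]
  rcases eq_or_ne j (Q - 1) with hjQ | hjQ
  · have := h k le_rfl (by rw [← hj, hjQ])
    have e : rt Q j = -rt Q (-1) := by
      rw [hjQ, ← rt_add_period hQ, neg_add_eq_sub]
    rw [e, neg_mul, Complex.neg_im]
    linarith
  · have := height_ge_of_not_crossed hQ hr hb he (fun i hi => h i hi.le) (j := j)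
      (by omega) (by omega)
    linarith

lemma Shear.eq_add_drift (hQ : 2 ≤ Q) {m : ℤ} {w w' : ℂ} (h : Shear Q m w w')
    (hpos : 0 < (rt Q (m % Q) * w).im) : w' = w + drift Q m := by
  obtain ⟨s, hs, h0, h1⟩ := h.congr hQ (j := m % Q) (Int.emod_emod_of_dvd _ dvd_rfl).symm
  rcases hs with rfl | rfl
  · rw [h1]; unfold drift; push_cast; ring
  · linarith

/-- Before the line `rt Q 1` is crossed, a shear path follows the drift. -/
lemma IsShearPath.eq_driftSum (hQ : 2 ≤ Q) (hr : IsCoprime r Q) {n : ℕ} {v : ℕ → ℂ}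
    (hv : IsShearPath Q r c n v) (hb : 0 ≤ (v 0).im) (he : (rt Q (-1) * v 0).im ≤ 0)
    (hfar : Q / Real.sin (Real.pi / Q) ≤ (v 0).im - (rt Q (-1) * v 0).im) {k : ℕ} (hk : k ≤ n)
    (h : ∀ i : ℕ, i < k → (r * i + c) % Q = Q - 1 →
      (rt Q (-1) * (v 0 + driftSum Q r c i)).im ≤ 0) :
    v k = v 0 + driftSum Q r c k := by
  induction k with
  | zero => rw [driftSum_zero, add_zero]
  | succ k ih =>
    have e := ih (by omega) (fun i hi => h i (by omega))
    have h1 := height_nonneg_of_not_crossed hQ hr hb he hfar (k := k)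
      (fun i hi => h i (by omega))
    rw [← e] at h1
    have h2 := hv k (by omega)
    have h3 := height_ne_zero_congr hQ (j := (r * k + c) % Q)
      (Int.emod_emod_of_dvd _ dvd_rfl).symm h2.2
    rw [h2.1.eq_add_drift hQ (lt_of_le_of_ne h1 h3.symm), e, driftSum_succ, add_assoc]

end Passage

end Shears

/-! ### The necklace of beads and the return map outside it -/

/-- The part of the section strip, seen from the center of a bead, that lies outside the bead on
the far side of the origin. -/
def InSection (Q : ℕ) (u : ℂ) : Prop :=
  |u.im| < kap Q / 2 ∧ 1 / 2 ≤ u.re ∧ ∃ j : ℤ, kap Q / 2 ≤ (rt Q j * u).im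

/-- The centers of the beads. -/
structure IsCenter (Q : ℕ) (r : ℤ) (n m : ℕ) (z : ℂ) : Prop where
  im_eq : z.im = kap Q / 2
  phase : r * n % Q = Q - 1
  lt : n < Q
  eq : (rt Q 1 - 1) * z = driftSum Q r 0 n + m * turn Q

section Far

variable {Q : ℕ} {r c : ℤ}

/-- The strip leaves no room for i < 0. If i = 0, the point is only rotated: it stays outside the
2Q-gon, hence outside the rectangle contained in it, and so to its right. If i ≥ 1, it is pushed
right and its height over the line of index 1 is large. -/
lemma InSection.step (hQ : 2 ≤ Q) {u u' : ℂ} (hu : InSection Q u) {i : ℤ}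
    (hu' : u' = rt Q (-1) * u + i * ⟨1, kap Q⟩) (him : |u'.im| < kap Q / 2) :
    InSection Q u' := by
  obtain ⟨h1, h2, j, hj⟩ := hu
  have hs := sin_angle_pos hQ
  have hc := cos_angle_nonneg hQ
  have hk := kap_pos hQ
  have hks := kap_mul_sin hQ
  have hs1 := Real.sin_le_one (Real.pi / Q)
  have hc1 := cos_angle_lt_one hQ
  have wim := rt_neg_one_mul_im (Q := Q) u
  have wre := rt_neg_one_mul_re (Q := Q) u
  rw [abs_lt] at h1
  have hre : -(1 / 2) < (rt Q (-1) * u).re := by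
    rw [wre]
    nlinarith
  have hi : (rt Q (-1) * u).im < kap Q / 2 := by
    rw [wim]
    nlinarith
  have e1 : u'.im = (rt Q (-1) * u).im + i * kap Q := by rw [hu']; simp
  have e2 : u'.re = (rt Q (-1) * u).re + i := by rw [hu']; simp
  have hi0 : 0 ≤ i := by
    by_contra hneg
    have : (i : ℝ) ≤ -1 := by exact_mod_cast (by omega : i ≤ -1)
    have h3 := (abs_lt.1 him).1
    rw [e1] at h3
    nlinarith
  rcases hi0.eq_or_lt with h0 | h0
  · have hu0 : u' = rt Q (-1) * u := by rw [hu', ← h0]; simp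
    have hj' : kap Q / 2 ≤ (rt Q (j + 1) * u').im := by
      rw [hu0, ← mul_assoc, ← rt_add, add_neg_cancel_right]; exact hj
    refine ⟨him, ?_, j + 1, hj'⟩
    by_contra hlt
    have : |u'.re| < 1 / 2 := by
      rw [abs_lt, hu0]
      rw [hu0] at hlt
      exact ⟨hre, not_le.1 hlt⟩
    exact absurd hj' (not_le.2 (height_lt_of_rectangle hQ this him _))
  · have hi1 : (1 : ℝ) ≤ i := by exact_mod_cast h0
    refine ⟨him, by rw [e2]; linarith, 1, ?_⟩
    have : (rt Q 1 * u').im = u.im + i * kap Q := by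
      rw [hu', ← rt_neg_one_mul_turn hQ, mul_add, ← mul_assoc, rt_mul_neg, mul_left_comm,
        ← mul_assoc (rt Q 1), rt_mul_neg]
      simp [turn]
    rw [this]
    nlinarith

lemma succ_emod_eq_zero {x : ℤ} (h : x % Q = Q - 1) : (x + 1) % Q = 0 := by
  have := Int.emod_add_mul_ediv x Q
  exact Int.emod_eq_zero_of_dvd ⟨x / Q + 1, by rw [h] at this; linarith⟩

/-- The symmetry of the partial sum up to the first phase of the line `rt Q 1`. -/
lemma driftSum_symm (hQ : 2 ≤ Q) {n : ℕ} (hn : r * n % Q = Q - 1) :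
    driftSum Q r 0 n + 1 + rt Q 1 = -rt Q 1 * (starRingEnd ℂ) (driftSum Q r 0 n) := by
  have hQ0 : (0 : ℤ) < Q := by omega
  -- The phases at the times i and n - i add up to Q - 1, so the two steps are mirror images.
  have hrev : ∀ i ∈ Finset.range n, drift Q (r * ((n - i : ℕ) : ℤ) + 0) =
      -rt Q 1 * (starRingEnd ℂ) (drift Q (r * i + 0)) := by
    intro i hi
    have hin := (Finset.mem_range.1 hi).le
    have h0 := Int.emod_nonneg (r * i) hQ0.ne'
    have h1 := Int.emod_lt_of_pos (r * i) hQ0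
    have e : (r * ((n - i : ℕ) : ℤ)) % Q = Q - 1 - (r * i) % Q := by
      rw [← Int.emod_eq_of_lt (a := Q - 1 - (r * i) % Q) (b := Q) (by omega) (by omega), ← hn,
        Nat.cast_sub hin, mul_sub]
      simp [Int.sub_emod]
    simp only [drift, add_zero]
    rw [e, map_neg, conj_rt, neg_mul_neg, neg_neg, ← rt_add,
      ← rt_add_period hQ]
    congr 1
    ring
  have hf0 : drift Q (r * ((0 : ℕ) : ℤ) + 0) = -1 := by simp [drift]
  have hfn : drift Q (r * (n : ℤ) + 0) = rt Q 1 := by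
    unfold drift
    rw [add_zero, hn, ← rt_add_period hQ]
    congr 1; ring
  have h1 : driftSum Q r 0 n + drift Q (r * (n : ℤ) + 0) =
      ∑ i ∈ Finset.range n, drift Q (r * ((i + 1 : ℕ) : ℤ) + 0) +
        drift Q (r * ((0 : ℕ) : ℤ) + 0) := by
    rw [← Finset.sum_range_succ' (fun i : ℕ => drift Q (r * (i : ℤ) + 0)), Finset.sum_range_succ]
    rfl
  have h2 : ∑ i ∈ Finset.range n, drift Q (r * ((i + 1 : ℕ) : ℤ) + 0) =
      -rt Q 1 * (starRingEnd ℂ) (driftSum Q r 0 n) := by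
    rw [driftSum, map_sum, Finset.mul_sum, ← Finset.sum_congr rfl hrev,
      ← Finset.sum_range_reflect]
    apply Finset.sum_congr rfl
    intro i hi
    have := Finset.mem_range.1 hi
    congr 4
    omega
  rw [hf0, hfn, h2] at h1
  linear_combination h1

/-- The mirror symmetry `driftSum_symm` forces the solution for m = 0 to have height κ/2. Since
`turn Q` is `rt Q 1 - 1` divided by 1 - cos(π/Q), each further turn moves the solution by a real
amount. -/
lemma exists_center (hQ : 2 ≤ Q) (hr : IsCoprime r Q) :
    ∃ (n : ℕ) (x : ℝ), ∀ m : ℕ,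
      IsCenter Q r n m ⟨x + m / (1 - Real.cos (Real.pi / Q)), kap Q / 2⟩ := by
  obtain ⟨n, hn, hph⟩ := exists_phase hQ hr 0 (j := Q - 1) (by omega) (by omega)
  rw [add_zero] at hph
  have hc := cos_angle_lt_one hQ
  have h1 := kap_mul_sin hQ
  have h2 := kap_mul_one_sub_cos hQ
  have hne : rt Q 1 - 1 ≠ 0 := by
    intro h
    have := congrArg Complex.im h
    rw [Complex.sub_im, rt_im] at this
    simp only [Int.cast_one, one_mul, Complex.one_im, sub_zero, Complex.zero_im] at this
    exact (sin_angle_pos hQ).ne' this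
  set X := driftSum Q r 0 n / (rt Q 1 - 1) with hX
  have hP : driftSum Q r 0 n = (rt Q 1 - 1) * X := by rw [hX, mul_div_cancel₀ _ hne]
  have him : X.im = kap Q / 2 := by
    have hs := driftSum_symm hQ hph
    rw [hP, map_mul, map_sub, conj_rt, map_one] at hs
    have e1 : (rt Q 1 - 1) * (X - (starRingEnd ℂ) X) = (rt Q 1 - 1) * (kap Q * I) := by
      have e2 : (rt Q 1 - 1) * (kap Q * I) = -(1 + rt Q 1) := by
        apply Complex.ext
        · simp [Complex.mul_re, rt_re, rt_im]
          linarith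
        · simp [Complex.mul_im, rt_re, rt_im]
          linarith
      rw [e2]
      linear_combination hs - (starRingEnd ℂ) X * rt_mul_neg (Q := Q) 1
    have e3 := mul_left_cancel₀ hne e1
    have := congrArg Complex.im e3
    simp at this
    linarith
  refine ⟨n, X.re, fun m => ⟨rfl, hph, hn, ?_⟩⟩
  have e : (⟨X.re + m / (1 - Real.cos (Real.pi / Q)), kap Q / 2⟩ : ℂ) =
      X + m * ((1 / (1 - Real.cos (Real.pi / Q)) : ℝ) : ℂ) := by
    apply Complex.ext
    · rw [Complex.add_re, mul_comm, Complex.re_ofReal_mul]; simp; ring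
    · rw [Complex.add_im, mul_comm, Complex.im_ofReal_mul, him]; simp
  have e4 : (rt Q 1 - 1) * ((1 / (1 - Real.cos (Real.pi / Q)) : ℝ) : ℂ) = turn Q := by
    have h3 : 1 - Real.cos (Real.pi / Q) ≠ 0 := by linarith
    rw [mul_comm]
    apply Complex.ext
    · rw [Complex.re_ofReal_mul, Complex.sub_re, rt_re]
      simp only [turn, Int.cast_one, one_mul, Complex.one_re]
      field_simp
      ring
    · rw [Complex.im_ofReal_mul, Complex.sub_im, rt_im]
      simp only [turn, Int.cast_one, one_mul, Complex.one_im]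
      field_simp
      linarith
  rw [e, mul_add, ← hP, mul_left_comm, e4]

/-- A path starting far out in a sector follows the drift for ever, or until it crosses into
the next sector. -/
lemma IsShearPath.drift_or_cross (hQ : 2 ≤ Q) (hr : IsCoprime r Q) {n : ℕ} {v : ℕ → ℂ}
    (hv : IsShearPath Q r c n v) (hb : 0 ≤ (v 0).im) (he : (rt Q (-1) * v 0).im < 0)
    (hfar : Q / Real.sin (Real.pi / Q) ≤ (v 0).im - (rt Q (-1) * v 0).im) :
    (∀ k ≤ n, v k = v 0 + driftSum Q r c k) ∨
      ∃ N ≤ n, (r * N + c) % Q = Q - 1 ∧ (∀ k ≤ N, v k = v 0 + driftSum Q r c k) ∧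
        0 < (rt Q (-1) * v N).im ∧ (rt Q (-1) * v N).im < kap Q := by
  classical
  by_cases hex : ∃ N : ℕ, N ≤ n ∧ (r * N + c) % Q = Q - 1 ∧
      0 < (rt Q (-1) * (v 0 + driftSum Q r c N)).im
  · right
    have hspec := Nat.find_spec hex
    have hmin : ∀ i < Nat.find hex, (r * i + c) % Q = Q - 1 →
        (rt Q (-1) * (v 0 + driftSum Q r c i)).im ≤ 0 := by
      intro i hi hph
      by_contra hlt
      exact Nat.find_min hex hi ⟨by omega, hph, not_le.1 hlt⟩
    set N := Nat.find hex
    have hall : ∀ k ≤ N, v k = v 0 + driftSum Q r c k := fun k hk =>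
      hv.eq_driftSum hQ hr hb he.le hfar (hk.trans hspec.1) (fun i hi => hmin i (by omega))
    refine ⟨N, hspec.1, hspec.2.1, hall, by rw [hall N le_rfl]; exact hspec.2.2, ?_⟩
    have hT : (rt Q (-1) * turn Q).im = kap Q := by rw [rt_neg_one_mul_turn hQ]
    -- Overshoot is below κ: the previous visit to this phase, Q steps earlier, was still below the
    -- line, and a full turn adds κ. For N < Q the start plays that role, as the missing steps only
    -- raise the height.
    rcases lt_or_ge N Q with hNQ | hNQ
    · have h1 := driftSum_add (Q := Q) r c N (Q - N)
      rw [show N + (Q - N) = Q by omega, driftSum_period hQ hr] at h1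
      have h2 := (driftSum_rotate_im_mem hQ r (r * N + c) (Q - N)).1
      rw [h1, mul_add, Complex.add_im] at hT
      rw [hall N le_rfl, mul_add, Complex.add_im]
      linarith
    · have hph : (r * ((N - Q : ℕ) : ℤ) + c) % Q = Q - 1 := by
        rw [← hspec.2.1, Nat.cast_sub hNQ, ← Int.add_mul_emod_self_left _ _ r]
        congr 1; ring
      have h0 := hmin (N - Q) (by omega) hph
      rw [← hall _ (Nat.sub_le _ _)] at h0
      have h1 := (hv (N - Q) (by omega)).2
      have h2 : (rt Q (-1) * v (N - Q)).im ≠ 0 := by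
        apply height_ne_zero_congr hQ _ h1
        rw [hph, ← Int.add_mul_emod_self_left _ _ 1,
          Int.emod_eq_of_lt (by omega) (by omega)]
        ring
      have h3 := lt_of_le_of_ne h0 h2
      have h4 : v N = v (N - Q) + turn Q := by
        rw [hall N le_rfl, hall _ (Nat.sub_le _ _), add_assoc]
        have := driftSum_add_mul_period hQ hr c (N - Q) 1
        rw [mul_one, Nat.sub_add_cancel hNQ] at this
        rw [this]; simp
      rw [h4, mul_add, Complex.add_im, hT]
      linarith
  · left
    push Not at hex
    intro k hk
    exact hv.eq_driftSum hQ hr hb he.le hfar hk (fun i hi => hex i (by omega))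

lemma norm_ge_of_drift (hQ : 2 ≤ Q) (hr : IsCoprime r Q) (v : ℂ) (k : ℕ) :
    v.im - (rt Q (-1) * v).im - Q ≤ 2 * ‖v + driftSum Q r c k‖ := by
  have h1 := sub_height_le (Q := Q) (v + driftSum Q r c k)
  have h2 := driftSum_sub_height hQ hr c k
  rw [mul_add, Complex.add_im, Complex.add_im] at h1
  linarith

lemma IsCenter.mod_eq (hr : IsCoprime r Q) {n₁ m : ℕ} {z : ℂ} (hz : IsCenter Q r n₁ m z) {N : ℕ}
    (hc : c % Q = 0) (hph : (r * N + c) % Q = Q - 1) : N % Q = n₁ := by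
  obtain ⟨a, ha⟩ := Int.dvd_of_emod_eq_zero hc
  have h1 : (r * N) % Q = (r * n₁) % Q := by
    rw [hz.phase, ← hph, ha, Int.add_mul_emod_self_left]
  have h2 := Int.dvd_of_emod_eq_zero (Int.emod_eq_emod_iff_emod_sub_eq_zero.1 h1)
  rw [← mul_sub] at h2
  have h3 := hr.symm.dvd_of_dvd_mul_left h2
  have h4 : (N : ℤ) % Q = (n₁ : ℤ) % Q :=
    Int.emod_eq_emod_iff_emod_sub_eq_zero.2 (Int.emod_eq_zero_of_dvd h3)
  have h5 : N % Q = n₁ % Q := by exact_mod_cast h4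
  rw [h5, Nat.mod_eq_of_lt hz.lt]

/-- The bead blocks: a path that starts in the section outside of a remote bead stays remote. -/
lemma far_of_section (hQ : 2 ≤ Q) (hr : IsCoprime r Q) {n₁ m : ℕ} {z : ℂ}
    (hz : IsCenter Q r n₁ m z) {R : ℝ} (hR : 0 ≤ R)
    (hzR : Q / Real.sin (Real.pi / Q) + kap Q + 2 * R + Q ≤ Real.sin (Real.pi / Q) * z.re)
    (n : ℕ) : ∀ (c : ℤ) (v : ℕ → ℂ), c % Q = 0 → IsShearPath Q r c n v →
      InSection Q (v 0 - z) → ∀ k ≤ n, R ≤ ‖v k‖ := by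
  induction n using Nat.strong_induction_on with
  | _ n ih =>
  intro c v hc hv hsec
  have hs := sin_angle_pos hQ
  have hco := cos_angle_nonneg hQ
  have hc1 := cos_angle_lt_one hQ
  have hk := kap_pos hQ
  have hsec1 := abs_lt.1 hsec.1
  have hsec2 := hsec.2.1
  have hQs : 0 ≤ Q / Real.sin (Real.pi / Q) := by positivity
  have hQ0 : (0 : ℝ) ≤ Q := by positivity
  rw [Complex.sub_im, hz.im_eq] at hsec1
  rw [Complex.sub_re] at hsec2
  have hb : 0 ≤ (v 0).im := by linarith
  have hre : Real.sin (Real.pi / Q) * z.re ≤ Real.sin (Real.pi / Q) * (v 0).re :=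
    mul_le_mul_of_nonneg_left (by linarith) hs.le
  have he := rt_neg_one_mul_im (Q := Q) (v 0)
  have he' : (rt Q (-1) * v 0).im < 0 := by
    rw [he]; nlinarith
  have hbe : Real.sin (Real.pi / Q) * z.re ≤ (v 0).im - (rt Q (-1) * v 0).im := by
    rw [he]; nlinarith
  have hnorm : ∀ k, v k = v 0 + driftSum Q r c k → R ≤ ‖v k‖ := by
    intro k hk
    have := norm_ge_of_drift (c := c) hQ hr (v 0) k
    rw [← hk] at this
    linarith
  rcases hv.drift_or_cross hQ hr hb he' (by linarith) with h | ⟨N, hNn, hph, hall, hp1, hp2⟩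
  · exact fun k hk => hnorm k (h k hk)
  -- The path starts in phase 0, not Q - 1, so the remaining length really drops.
  have hN0 : N ≠ 0 := by
    rintro rfl
    rw [Nat.cast_zero, mul_zero, zero_add, hc] at hph
    omega
  have hNmod : N % Q = n₁ := hz.mod_eq hr hc hph
  have hNe : v N = v 0 + (driftSum Q r 0 n₁ + (N / Q : ℕ) * turn Q) := by
    rw [hall N le_rfl]
    conv_lhs => rw [← Nat.mod_add_div N Q, driftSum_add_mul_period hQ hr, hNmod]
    rw [driftSum_congr (c' := 0) (by rw [hc]; simp)]
  -- The center makes the same passage with m turns instead of N / Q; the surplus turns, rotated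
  -- back, are multiples of (1, κ).
  have hstep : rt Q (-1) * v N - z = rt Q (-1) * (v 0 - z) +
      (((N / Q : ℕ) : ℤ) - (m : ℤ) : ℤ) * ⟨1, kap Q⟩ := by
    rw [← rt_neg_one_mul_turn hQ, hNe]
    generalize N / Q = K
    push_cast
    linear_combination (-rt Q (-1)) * hz.eq + z * rt_neg_mul (Q := Q) 1
  have hsec' : InSection Q (rt Q (-1) * v N - z) := by
    apply hsec.step hQ hstep
    rw [abs_lt, Complex.sub_im, hz.im_eq]
    constructor <;> linarith
  have hpath := (hv.shift hNn).rotate (i := 1)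
  have hc' : (r * N + c + 1) % Q = 0 := succ_emod_eq_zero hph
  have hrec := ih (n - N) (by omega) _ _ hc' hpath hsec'
  intro k hk
  rcases le_or_gt k N with hkN | hkN
  · exact hnorm k (hall k hkN)
  · have := hrec (k - N) (by omega)
    rwa [norm_mul, norm_rt, one_mul, Nat.add_sub_cancel' hkN.le] at this

/-- Paths that start far away from the origin stay far away. -/
lemma exists_far (hQ : 2 ≤ Q) (hr : IsCoprime r Q) (R : ℝ) : ∃ R' : ℝ, 0 < R' ∧
    ∀ (n : ℕ) (v : ℕ → ℂ), IsShearPath Q r 0 n v → R' ≤ ‖v 0‖ → ∀ k ≤ n, R ≤ ‖v k‖ := by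
  obtain ⟨n₁, x, hcen⟩ := exists_center hQ hr
  have hs := sin_angle_pos hQ
  have hs1 := Real.sin_le_one (Real.pi / Q)
  have hco := cos_angle_nonneg hQ
  have hc1 := cos_angle_lt_one hQ
  have hk := kap_pos hQ
  set σ := Real.sin (Real.pi / Q) with hσ
  obtain ⟨m, hm⟩ := exists_nat_ge (((Q / σ + kap Q + 2 * |R| + Q) / σ - x) *
    (1 - Real.cos (Real.pi / Q)))
  have hz := hcen m
  set z : ℂ := ⟨x + m / (1 - Real.cos (Real.pi / Q)), kap Q / 2⟩ with hzdef
  have hzR : Q / σ + kap Q + 2 * |R| + Q ≤ σ * z.re := by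
    have h1 : (Q / σ + kap Q + 2 * |R| + Q) / σ - x ≤ m / (1 - Real.cos (Real.pi / Q)) := by
      rw [le_div_iff₀ (by linarith)]; exact hm
    have h2 : (Q / σ + kap Q + 2 * |R| + Q) / σ ≤ z.re := by
      simp only [hzdef]; linarith
    rw [div_le_iff₀ hs] at h2
    linarith
  have hQs : 0 ≤ Q / σ := by positivity
  have hQ0 : (0 : ℝ) ≤ Q := by positivity
  have hR0 := abs_nonneg R
  -- `Q / σ` lets the drift govern the first passage, `Q + 2 * |R|` keeps that passage remote, and
  -- the last bracket makes the first crossing land to the right of z, outside the bead.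
  set D := Q / σ + Q + 2 * |R| + (σ * z.re + 1 / 2 + kap Q) with hD
  have hDpos : 0 < D := by linarith
  refine ⟨D / σ, by positivity, ?_⟩
  intro n v hv hv0
  rw [div_le_iff₀ hs] at hv0
  have hvne : v 0 ≠ 0 := by
    intro h
    rw [h, norm_zero, zero_mul] at hv0
    linarith
  obtain ⟨J, hJ1, hJ2⟩ := exists_sector hQ hvne
  have hpath := hv.rotate (i := J)
  have hbe := norm_mul_sin_le hQ hJ1 hJ2.le
  rw [norm_mul, norm_rt, one_mul] at hbe
  have hbe' : D ≤ (rt Q (-J) * v 0).im - (rt Q (-1) * (rt Q (-J) * v 0)).im := by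
    linarith
  have hnorm : ∀ k, rt Q (-J) * v k = rt Q (-J) * v 0 + driftSum Q r (0 + J) k → R ≤ ‖v k‖ := by
    intro k hk
    have := norm_ge_of_drift (c := 0 + J) hQ hr (rt Q (-J) * v 0) k
    rw [← hk, norm_mul _ (v k), norm_rt, one_mul] at this
    linarith [le_abs_self R]
  rcases hpath.drift_or_cross hQ hr hJ1 hJ2 (by linarith) with h | ⟨N, hNn, hph, hall, hp1, hp2⟩
  · exact fun k hk => hnorm k (h k hk)
  have hpath' := (hpath.shift hNn).rotate (i := 1)
  have hc' : (r * N + (0 + J) + 1) % Q = 0 := succ_emod_eq_zero hph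
  set w := rt Q (-1) * (rt Q (-J) * v N) with hw
  have hwN : (rt Q 1 * w).im - w.im = (rt Q (-J) * v N).im - w.im := by
    rw [hw, ← mul_assoc, rt_mul_neg, one_mul]
  have hge : D - Q ≤ (rt Q 1 * w).im - w.im := by
    have e : rt Q (-J) * v N = rt Q (-J) * v 0 + driftSum Q r (0 + J) N := hall N le_rfl
    have := driftSum_sub_height hQ hr (0 + J) N
    rw [hwN, hw, e, mul_add, Complex.add_im, Complex.add_im]
    linarith
  rw [rt_one_mul_im] at hge
  have hwre : σ * z.re + 1 / 2 + kap Q ≤ σ * w.re := by nlinarith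
  have hsec : InSection Q (w - z) := by
    have hure : 1 / 2 + kap Q ≤ σ * (w - z).re := by rw [Complex.sub_re]; linarith
    have h0 : 0 ≤ (w - z).re := by
      by_contra hneg
      nlinarith
    have him : |(w - z).im| < kap Q / 2 := by
      rw [abs_lt, Complex.sub_im, hz.im_eq]; constructor <;> linarith
    refine ⟨him, by nlinarith, 1, ?_⟩
    rw [rt_one_mul_im]
    have := abs_lt.1 him
    nlinarith
  have hrec := far_of_section hQ hr hz hR0 hzR (n - N) _ _ hc' hpath' hsec
  intro k hk
  rcases le_or_gt k N with hkN | hkN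
  · exact hnorm k (hall k hkN)
  · have := hrec (k - N) (by omega)
    rw [norm_mul, norm_rt, one_mul, norm_mul, norm_rt, one_mul, Nat.add_sub_cancel' hkN.le] at this
    exact (le_abs_self R).trans this

end Far

/-! ### From shear paths to orbits of F -/

section Orbits

variable {Q : ℕ} {r c : ℤ}

/-- Q counts the lines λ^k ℝ: it is q/2 with r = p for even q, and q with r = 2p for odd q. -/
lemma exists_rotMult_eq_rt {p q : ℕ} (hq : 3 ≤ q) (hpq : Nat.Coprime p q) :
    ∃ (Q : ℕ) (r : ℤ), 2 ≤ Q ∧ IsCoprime r Q ∧ rotMult p q = rt Q r := by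
  rcases Nat.even_or_odd q with ⟨Q, hQ⟩ | hodd
  · refine ⟨Q, p, by omega, ?_, ?_⟩
    · rw [Nat.isCoprime_iff_coprime]
      exact Nat.Coprime.coprime_dvd_right ⟨2, by omega⟩ hpq
    · unfold rotMult rt
      congr 3
      have : (Q : ℝ) ≠ 0 := by
        have : Q ≠ 0 := by omega
        exact_mod_cast this
      rw [hQ]
      push_cast
      field_simp
      ring
  · refine ⟨q, ((2 * p : ℕ) : ℤ), by omega, ?_, ?_⟩
    · rw [Nat.isCoprime_iff_coprime]
      exact Nat.Coprime.mul_left (Nat.coprime_two_left.2 hodd) hpq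
    · unfold rotMult rt
      congr 3
      push_cast
      ring

lemma stepH_eq (z : ℂ) : ∃ s : ℝ, (s = 1 ∨ s = -1) ∧ 0 ≤ s * z.im ∧ stepH z = s := by
  unfold stepH
  by_cases h : 0 ≤ z.im
  · exact ⟨1, Or.inl rfl, by linarith, by simp [h]⟩
  · exact ⟨-1, Or.inr rfl, by linarith, by simp [h]⟩

/-- Undoing the accumulated rotation λ^k leaves only the translation by a unit vector on the line
λ^(-k) ℝ. -/
lemma shear_of_pwRot (z : ℂ) (k : ℕ) :
    Shear Q (r * k) (rt Q (-(r * k)) * z)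
      (rt Q (-(r * (k + 1 : ℕ))) * pwRot (rt Q r) z) := by
  obtain ⟨s, hs, h0, h1⟩ := stepH_eq z
  refine ⟨s, hs, ?_, ?_⟩
  · rwa [← mul_assoc, rt_mul_neg, one_mul]
  · unfold pwRot
    rw [h1, ← mul_assoc, ← rt_add, show -(r * ((k + 1 : ℕ) : ℤ)) + r = -(r * k) by push_cast; ring]
    ring

lemma isShearPath_of_orbit {n : ℕ} {z : ℕ → ℂ}
    (h : ∀ k < n, z (k + 1) = pwRot (rt Q r) (z k) ∧ (z k).im ≠ 0) :
    IsShearPath Q r 0 n (fun k => rt Q (-(r * k)) * z k) := by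
  intro k hk
  simp only [add_zero]
  refine ⟨?_, ?_⟩
  · rw [(h k hk).1]; exact shear_of_pwRot _ _
  · rw [← mul_assoc, rt_mul_neg, one_mul]; exact (h k hk).2

/-- Time reversal. -/
lemma pwRot_reverse {l w : ℂ} (hl : ‖l‖ = 1) (hw : w.im ≠ 0) :
    pwRot l (l * (starRingEnd ℂ) (pwRot l w)) = l * (starRingEnd ℂ) w ∧
      (l * (starRingEnd ℂ) (pwRot l w)).im ≠ 0 := by
  have hll : l * (starRingEnd ℂ) l = 1 := by
    rw [Complex.mul_conj, Complex.normSq_eq_norm_sq, hl]; simp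
  have e : l * (starRingEnd ℂ) (pwRot l w) = (starRingEnd ℂ) w - stepH w := by
    have hH : (starRingEnd ℂ) (stepH w) = stepH w := by
      unfold stepH; split_ifs <;> simp
    unfold pwRot
    rw [map_mul, map_sub, hH]
    linear_combination ((starRingEnd ℂ) w - stepH w) * hll
  have him : ((starRingEnd ℂ) w - stepH w).im = -w.im := by
    unfold stepH; split_ifs <;> simp
  have hstep : stepH ((starRingEnd ℂ) w - stepH w) = -stepH w := by
    unfold stepH at him ⊢
    rw [him]
    rcases lt_or_gt_of_ne hw with h | h
    · rw [if_pos (by linarith), if_neg (by linarith)]; simp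
    · rw [if_neg (by linarith), if_pos h.le]
  rw [e]
  refine ⟨?_, by rw [him]; exact neg_ne_zero.2 hw⟩
  unfold pwRot
  rw [hstep]
  ring

/-- Orbits that avoid the real line are bounded. -/
lemma orbit_bounded (hQ : 2 ≤ Q) (hr : IsCoprime r Q) {z : ℂ}
    (hz : ∀ k : ℕ, ((pwRot (rt Q r))^[k] z).im ≠ 0) :
    ∃ C : ℝ, ∀ n : ℕ, ‖(pwRot (rt Q r))^[n] z‖ ≤ C := by
  obtain ⟨R', _, hR'⟩ := exists_far hQ hr (‖z‖ + 1)
  refine ⟨R', fun n => ?_⟩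
  by_contra! hlt
  -- The reversed orbit starts far out, so it would keep norm at least ‖z‖ + 1; but it ends at a
  -- point of norm ‖z‖.
  set y : ℕ → ℂ := fun i => rt Q r * (starRingEnd ℂ) ((pwRot (rt Q r))^[n - i] z) with hy
  have hpath : ∀ i < n, y (i + 1) = pwRot (rt Q r) (y i) ∧ (y i).im ≠ 0 := by
    intro i hi
    have e : n - i = (n - (i + 1)) + 1 := by omega
    have h := pwRot_reverse (norm_rt (Q := Q) r) (hz (n - (i + 1)))
    simp only [hy]
    rw [e, Function.iterate_succ_apply']
    exact ⟨h.1.symm, h.2⟩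
  have h := hR' n _ (isShearPath_of_orbit hpath) (by
    simp only [hy, norm_mul, norm_rt, one_mul, RCLike.norm_conj, Nat.sub_zero]
    exact hlt.le) n le_rfl
  simp only [hy, norm_mul, norm_rt, one_mul, RCLike.norm_conj, Nat.sub_self,
    Function.iterate_zero, id_eq] at h
  linarith

/-! ### Orbits of the bead centers -/

section Center

variable {n₁ m : ℕ} {z : ℂ}

lemma IsCenter.n_ne_zero (hQ : 2 ≤ Q) (hz : IsCenter Q r n₁ m z) : n₁ ≠ 0 := by
  rintro rfl
  have := hz.phase
  simp at this
  omega

/-- For i = m the passage, rotated back by one sector, ends at z itself. -/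
lemma IsCenter.add_driftSum (hQ : 2 ≤ Q) (hr : IsCoprime r Q) (hz : IsCenter Q r n₁ m z)
    (hc : c % Q = 0) (i : ℕ) :
    rt Q (-1) * (z + driftSum Q r c (n₁ + Q * i)) = z + ((i : ℂ) - m) * ⟨1, kap Q⟩ := by
  rw [driftSum_congr (c' := 0) (by rw [hc]; simp), driftSum_add_mul_period hQ hr,
    ← rt_neg_one_mul_turn hQ]
  linear_combination (-rt Q (-1)) * hz.eq + z * rt_neg_mul (Q := Q) 1

/-- Phase Q - 1 occurs only at the times n₁ + Q a; for a < m the height is then κ/2 + (a - m)κ. -/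
lemma IsCenter.not_crossed (hQ : 2 ≤ Q) (hr : IsCoprime r Q) (hz : IsCenter Q r n₁ m z)
    (hc : c % Q = 0) {i : ℕ} (hi : i < n₁ + Q * m) (hph : (r * i + c) % Q = Q - 1) :
    (rt Q (-1) * (z + driftSum Q r c i)).im ≤ -(kap Q / 2) := by
  have hmod := hz.mod_eq hr hc hph
  have hi' := Nat.mod_add_div i Q
  rw [hmod] at hi'
  rw [← hi', hz.add_driftSum hQ hr hc]
  have hlt : i / Q < m := by
    have : Q * (i / Q) < Q * m := by omega
    exact lt_of_mul_lt_mul_left this (Nat.zero_le _)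
  generalize i / Q = a at hlt
  have h1 : (a : ℝ) + 1 ≤ m := by exact_mod_cast hlt
  have e : (z + ((a : ℂ) - m) * ⟨1, kap Q⟩).im = kap Q / 2 + (a - m) * kap Q := by
    simp [hz.im_eq]
  rw [e]
  nlinarith [kap_pos hQ]

lemma IsCenter.height_ge (hQ : 2 ≤ Q) (hr : IsCoprime r Q) (hz : IsCenter Q r n₁ m z)
    (hzR : Q / Real.sin (Real.pi / Q) + kap Q ≤ Real.sin (Real.pi / Q) * z.re)
    (hc : c % Q = 0) {k : ℕ} (hk : k < n₁ + Q * m) :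
    kap Q / 2 ≤ (rt Q ((r * k + c) % Q) * (z + driftSum Q r c k)).im := by
  have hQ0 : (0 : ℤ) < Q := by omega
  have hs := sin_angle_pos hQ
  have hco := cos_angle_nonneg hQ
  have hc1 := cos_angle_lt_one hQ
  have hkp := kap_pos hQ
  have hQs : 0 ≤ Q / Real.sin (Real.pi / Q) := by positivity
  have h0 := Int.emod_nonneg (r * k + c) hQ0.ne'
  have h1 := Int.emod_lt_of_pos (r * k + c) hQ0
  have him := hz.im_eq
  have he := rt_neg_one_mul_im (Q := Q) z
  rw [him] at he
  have hnc := fun i (hi : i < n₁ + Q * m) => hz.not_crossed (i := i) hQ hr hc hi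
  set j := (r * k + c) % Q with hj
  rcases eq_or_ne j 0 with hj0 | hj0
  · rw [hj0, rt_zero, one_mul, Complex.add_im, him]
    linarith [(driftSum_im_mem hQ r c k).1]
  rcases eq_or_ne j (Q - 1) with hjQ | hjQ
  · have := hnc k hk (by rw [← hj, hjQ])
    have e : rt Q j = -rt Q (-1) := by
      rw [hjQ, ← rt_add_period hQ, neg_add_eq_sub]
    rw [e, neg_mul, Complex.neg_im]
    linarith
  · have := height_ge_of_not_crossed (v := z) (c := c) (k := k) hQ hr (by rw [him]; linarith)
      (by rw [he]; nlinarith)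
      (fun i hi hph => (hnc i (by omega) hph).trans (by linarith)) (j := j)
      (by omega) (by omega)
    rw [he, him] at this
    nlinarith

lemma IsCenter.eq_driftSum (hQ : 2 ≤ Q) (hr : IsCoprime r Q) (hz : IsCenter Q r n₁ m z)
    (hzR : Q / Real.sin (Real.pi / Q) + kap Q ≤ Real.sin (Real.pi / Q) * z.re)
    (hc : c % Q = 0) {v : ℕ → ℂ} (hv : ∀ k : ℕ, Shear Q (r * k + c) (v k) (v (k + 1)))
    (hv0 : v 0 = z) {k : ℕ} (hk : k ≤ n₁ + Q * m) : v k = z + driftSum Q r c k := by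
  induction k with
  | zero => rw [hv0, driftSum_zero, add_zero]
  | succ k ih =>
    have e := ih (by omega)
    have h := hz.height_ge hQ hr hzR hc (k := k) (by omega)
    rw [← e] at h
    rw [(hv k).eq_add_drift hQ (by linarith [kap_pos hQ]), e, driftSum_succ, add_assoc]

/-- After n₁ + Q m steps the rotated path is at z again, in phase 0, so the bound for a single
passage propagates by induction. -/
lemma IsCenter.abs_height_ge (hQ : 2 ≤ Q) (hr : IsCoprime r Q) (hz : IsCenter Q r n₁ m z)
    (hzR : Q / Real.sin (Real.pi / Q) + kap Q ≤ Real.sin (Real.pi / Q) * z.re) (k : ℕ) :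
    ∀ (c : ℤ) (v : ℕ → ℂ), c % Q = 0 → (∀ k : ℕ, Shear Q (r * k + c) (v k) (v (k + 1))) →
      v 0 = z → kap Q / 2 ≤ |(rt Q (r * k + c) * v k).im| := by
  induction k using Nat.strong_induction_on with
  | _ k ih =>
  intro c v hc hv hv0
  have heq := fun k hk => hz.eq_driftSum (k := k) hQ hr hzR hc hv hv0 hk
  rcases lt_or_ge k (n₁ + Q * m) with hk | hk
  · have h := hz.height_ge hQ hr hzR hc hk
    rw [← heq k hk.le] at h
    rw [abs_height_congr hQ (j := (r * k + c) % Q) (Int.emod_emod_of_dvd _ dvd_rfl).symm]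
    exact h.trans (le_abs_self _)
  · have hn := hz.n_ne_zero hQ
    set N := n₁ + Q * m with hN
    have hph : (r * N + c) % Q = Q - 1 := by
      obtain ⟨a, ha⟩ := Int.dvd_of_emod_eq_zero hc
      rw [hN, ha, ← hz.phase, ← Int.add_mul_emod_self_left (r * n₁) Q (r * m + a)]
      congr 1
      push_cast
      ring
    have hv' : ∀ k : ℕ, Shear Q (r * k + (r * N + c + 1)) (rt Q (-1) * v (N + k))
        (rt Q (-1) * v (N + (k + 1))) := by
      intro k
      have := (hv (N + k)).rotate (i := 1)
      rwa [show r * ((N + k : ℕ) : ℤ) + c + 1 = r * k + (r * N + c + 1) by push_cast; ring] at this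
    have h := ih (k - N) (by omega) (r * N + c + 1) (fun k => rt Q (-1) * v (N + k))
      (succ_emod_eq_zero hph) hv' (by
        rw [add_zero, heq N le_rfl, hN, hz.add_driftSum hQ hr hc]; simp)
    rw [Nat.add_sub_cancel' hk, ← mul_assoc, ← rt_add, Nat.cast_sub hk,
      show r * ((k : ℤ) - N) + (r * N + c + 1) + -1 = r * k + c by ring] at h
    exact h

end Center

/-- The second step has positive height because Q does not divide r, and no step has negative
height. -/
lemma driftSum_ne_zero (hQ : 2 ≤ Q) (hr : IsCoprime r Q) {k : ℕ} (hk : k ≠ 0) :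
    driftSum Q r 0 k ≠ 0 := by
  rcases Nat.lt_or_ge k 2 with h | h
  · obtain rfl : k = 1 := by omega
    simp [driftSum, drift]
  · obtain ⟨l, rfl⟩ := Nat.exists_eq_add_of_le h
    intro h0
    have h1 := congrArg Complex.im h0
    rw [driftSum_add, Complex.add_im, Complex.zero_im] at h1
    have h2 := (driftSum_im_mem hQ r (r * (2 : ℕ) + 0) l).1
    have hQ0 : (0 : ℤ) < Q := by omega
    have hrQ : r % Q ≠ 0 := by
      intro h
      have hd := Int.dvd_of_emod_eq_zero h
      have := Int.isUnit_iff.1 (hr.symm.isUnit_of_dvd' dvd_rfl hd)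
      omega
    have h3 := sin_angle_le_sin_mul hQ (j := r % Q)
      (by have := Int.emod_nonneg r hQ0.ne'; omega) (Int.emod_lt_of_pos r hQ0)
    have h4 : (driftSum Q r 0 2).im = Real.sin ((r % Q : ℤ) * (Real.pi / Q)) := by
      rw [driftSum, Finset.sum_range_succ, Finset.sum_range_one]
      unfold drift
      rw [Complex.add_im, Complex.neg_im, Complex.neg_im, rt_im, rt_im]
      push_cast
      simp [Real.sin_neg]
    linarith [sin_angle_pos hQ]

/-- There are points of arbitrarily large period whose orbits keep a distance to the real line. -/
lemma exists_center_long_period (hQ : 2 ≤ Q) (hr : IsCoprime r Q) (K : ℕ) :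
    ∃ z : ℂ, (∀ k : ℕ, kap Q / 2 ≤ |((pwRot (rt Q r))^[k] z).im|) ∧
      ∀ k : ℕ, k ≠ 0 → k ≤ K → (pwRot (rt Q r))^[k] z ≠ z := by
  obtain ⟨n₁, x, hcen⟩ := exists_center hQ hr
  have hs := sin_angle_pos hQ
  have hco := cos_angle_nonneg hQ
  have hc1 := cos_angle_lt_one hQ
  set σ := Real.sin (Real.pi / Q) with hσ
  -- A center returning at time k during its first passage must be this quotient, so it suffices to
  -- place z beyond all of them. If λ^k = 1 the junk value is 0, and no return is possible since the
  -- drift sum is nonzero.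
  set a : ℕ → ℝ := fun k => ‖driftSum Q r 0 k / (rt Q (-(r * k)) - 1)‖ with ha
  set B := (Q / σ + kap Q) / σ + (∑ k ∈ Finset.range (K + 1), a k + 1) with hB
  obtain ⟨m₀, hm₀⟩ := exists_nat_ge ((B - x) * (1 - Real.cos (Real.pi / Q)))
  -- Adding K makes the first passage last at least K steps.
  set m := m₀ + K with hm
  have hz := hcen m
  set z : ℂ := ⟨x + m / (1 - Real.cos (Real.pi / Q)), kap Q / 2⟩ with hzdef
  have hasum : 0 ≤ ∑ k ∈ Finset.range (K + 1), a k :=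
    Finset.sum_nonneg fun k _ => norm_nonneg _
  have hzB : B ≤ z.re := by
    have h1 : B - x ≤ m / (1 - Real.cos (Real.pi / Q)) := by
      rw [le_div_iff₀ (by linarith)]
      have : (m₀ : ℝ) ≤ m := by exact_mod_cast Nat.le_add_right _ _
      linarith
    simp only [hzdef]; linarith
  have hzR : Q / σ + kap Q ≤ σ * z.re := by
    have h2 : (Q / σ + kap Q) / σ ≤ z.re := by linarith
    rw [div_le_iff₀ hs] at h2
    linarith
  have hv : ∀ k : ℕ, Shear Q (r * k + 0) (rt Q (-(r * k)) * (pwRot (rt Q r))^[k] z)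
      (rt Q (-(r * (k + 1 : ℕ))) * (pwRot (rt Q r))^[k + 1] z) := by
    intro k
    rw [Function.iterate_succ_apply', add_zero]
    exact shear_of_pwRot _ _
  refine ⟨z, fun k => ?_, fun k hk0 hkK hfix => ?_⟩
  · have := hz.abs_height_ge hQ hr hzR k 0 (fun k => rt Q (-(r * k)) * (pwRot (rt Q r))^[k] z)
      (by simp) hv (by simp)
    rwa [add_zero, ← mul_assoc, rt_mul_neg, one_mul] at this
  · have hkm : k ≤ n₁ + Q * m := by nlinarith
    have h := hz.eq_driftSum hQ hr hzR (c := 0) (by simp)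
      (v := fun k : ℕ => rt Q (-(r * k)) * (pwRot (rt Q r))^[k] z) hv (by simp) hkm
    rw [hfix] at h
    have h1 : (rt Q (-(r * k)) - 1) * z = driftSum Q r 0 k := by linear_combination h
    have h2 : rt Q (-(r * k)) - 1 ≠ 0 := by
      intro h0
      rw [h0, zero_mul] at h1
      exact driftSum_ne_zero hQ hr hk0 h1.symm
    have h3 : z = driftSum Q r 0 k / (rt Q (-(r * k)) - 1) := by
      rw [← h1, mul_div_cancel_left₀ _ h2]
    have h4 : z.re ≤ a k := by
      simp only [ha]
      rw [← h3]
      exact Complex.re_le_norm z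
    have h5 : a k ≤ ∑ k ∈ Finset.range (K + 1), a k :=
      Finset.single_le_sum (f := a) (fun k _ => norm_nonneg _)
        (Finset.mem_range.2 (Nat.lt_succ_of_le hkK))
    have h6 : 0 ≤ (Q / σ + kap Q) / σ := by
      have := kap_pos hQ
      positivity
    linarith

end Orbits

/-! ### Tiles: convexity, boundedness, periodicity, centers -/

/-- Nonreal roots of unity for which the orbits avoiding the real line are bounded. -/
structure IsTameMult (l : ℂ) (q : ℕ) : Prop where
  norm_eq : ‖l‖ = 1
  im_ne : l.im ≠ 0
  pos : 0 < q
  pow_eq : l ^ q = 1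
  bounded : ∀ z : ℂ, (∀ k : ℕ, ((pwRot l)^[k] z).im ≠ 0) →
    ∃ C : ℝ, ∀ n : ℕ, ‖(pwRot l)^[n] z‖ ≤ C

section Tiles

variable {l : ℂ} {V : Set ℂ}

lemma isOpen_regularSet : IsOpen (regularSet l) := isClosed_closure.isOpen_compl

lemma im_ne_zero_of_mem_regularSet {z : ℂ} (hz : z ∈ regularSet l) (i : ℕ) :
    ((pwRot l)^[i] z).im ≠ 0 := fun h => hz (subset_closure ⟨i, h⟩)

lemma subset_regularSet {S : Set ℂ} (hS : IsOpen S)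
    (h : ∀ z ∈ S, ∀ i : ℕ, ((pwRot l)^[i] z).im ≠ 0) : S ⊆ regularSet l := by
  intro z hz hcl
  obtain ⟨w, hw, i, hi⟩ := mem_closure_iff.1 hcl S hS hz
  exact h w hw i hi

lemma IsTile.isOpen (hV : IsTile l V) : IsOpen V := by
  obtain ⟨z, _, rfl⟩ := hV
  exact isOpen_regularSet.connectedComponentIn

lemma IsTile.isPreconnected (hV : IsTile l V) : IsPreconnected V := by
  obtain ⟨z, _, rfl⟩ := hV
  exact isPreconnected_connectedComponentIn

lemma IsTile.subset (hV : IsTile l V) : V ⊆ regularSet l := by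
  obtain ⟨z, _, rfl⟩ := hV
  exact connectedComponentIn_subset _ _

lemma IsTile.nonempty (hV : IsTile l V) : V.Nonempty := by
  obtain ⟨z, hz, rfl⟩ := hV
  exact ⟨z, mem_connectedComponentIn hz⟩

lemma IsTile.im_ne_zero (hV : IsTile l V) {z : ℂ} (hz : z ∈ V) (i : ℕ) :
    ((pwRot l)^[i] z).im ≠ 0 := im_ne_zero_of_mem_regularSet (hV.subset hz) i

lemma IsTile.subset_of_inter (hV : IsTile l V) {S : Set ℂ} (hS : IsPreconnected S)
    (hSU : S ⊆ regularSet l) {z : ℂ} (hzS : z ∈ S) (hzV : z ∈ V) : S ⊆ V := by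
  obtain ⟨w, hw, rfl⟩ := hV
  rw [connectedComponentIn_eq hzV]
  exact hS.subset_connectedComponentIn hzS hSU

lemma IsTile.eq_of_inter {W : Set ℂ} (hV : IsTile l V) (hW : IsTile l W) {z : ℂ} (hzV : z ∈ V)
    (hzW : z ∈ W) : V = W :=
  (hW.subset_of_inter hV.isPreconnected hV.subset hzV hzW).antisymm
    (hV.subset_of_inter hW.isPreconnected hW.subset hzW hzV)

lemma pwRot_injective (hl : l ≠ 0) : Function.Injective (pwRot l) := by
  intro z w h
  have h1 : z - stepH z = w - stepH w := mul_left_cancel₀ hl h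
  have him : z.im = w.im := by
    have hH : ∀ u, (stepH u).im = 0 := by
      intro u; unfold stepH; split_ifs <;> simp
    have := congrArg Complex.im h1
    simpa [hH] using this
  have hs : stepH z = stepH w := by unfold stepH; rw [him]
  rw [hs] at h1
  exact sub_left_injective h1

lemma pwRot_sub_of_same_side {z w : ℂ} (h : 0 < z.im * w.im) :
    pwRot l w = pwRot l z + l * (w - z) := by
  have hs : stepH w = stepH z := by
    unfold stepH
    rcases pos_and_pos_or_neg_and_neg_of_mul_pos h with ⟨h1, h2⟩ | ⟨h1, h2⟩
    · rw [if_pos h1.le, if_pos h2.le]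
    · rw [if_neg (by linarith), if_neg (by linarith)]
  unfold pwRot
  rw [hs]; ring

lemma iterate_sub_of_same_side {z w : ℂ} {n : ℕ}
    (h : ∀ k < n, 0 < ((pwRot l)^[k] z).im * ((pwRot l)^[k] w).im) :
    (pwRot l)^[n] w = (pwRot l)^[n] z + l ^ n * (w - z) := by
  induction n with
  | zero => simp
  | succ n ih =>
    rw [Function.iterate_succ_apply', Function.iterate_succ_apply',
      pwRot_sub_of_same_side (h n (Nat.lt_succ_self n)), ih (fun k hk => h k (by omega))]
    ring

/-- Points of a connected set that never meets the line stay on the same side of it. -/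
lemma same_side_of_isPreconnected {S : Set ℂ} (hS : IsPreconnected S)
    (hne : ∀ z ∈ S, ∀ i : ℕ, ((pwRot l)^[i] z).im ≠ 0) {z w : ℂ} (hz : z ∈ S) (hw : w ∈ S)
    (n : ℕ) : 0 < ((pwRot l)^[n] z).im * ((pwRot l)^[n] w).im := by
  induction n using Nat.strong_induction_on generalizing w with
  | _ n ih =>
  -- Equal sides up to time n make the n-th iterate affine on S, so the heights form an interval
  -- that misses 0.
  have haff : ∀ u ∈ S, (pwRot l)^[n] u = (pwRot l)^[n] z + l ^ n * (u - z) := fun u hu =>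
    iterate_sub_of_same_side fun k hk => ih k hk hu
  have hcont : ContinuousOn (fun u => ((pwRot l)^[n] u).im) S := by
    have : ContinuousOn (fun u => ((pwRot l)^[n] z + l ^ n * (u - z)).im) S := by fun_prop
    exact this.congr fun u hu => by simp only [haff u hu]
  have hord := (hS.image _ hcont).ordConnected
  have h0 : (0 : ℝ) ∉ (fun u => ((pwRot l)^[n] u).im) '' S := by
    rintro ⟨u, hu, h⟩
    exact hne u hu n h
  have hz' := hne z hz n
  have hw' := hne w hw n
  by_contra hcon
  have hneg := lt_of_le_of_ne (not_lt.1 hcon) (mul_ne_zero hz' hw')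
  rcases mul_neg_iff.1 hneg with ⟨h1, h2⟩ | ⟨h1, h2⟩
  · exact h0 (hord.out (mem_image_of_mem _ hw) (mem_image_of_mem _ hz) ⟨h2.le, h1.le⟩)
  · exact h0 (hord.out (mem_image_of_mem _ hz) (mem_image_of_mem _ hw) ⟨h1.le, h2.le⟩)

lemma IsTile.same_side (hV : IsTile l V) {z w : ℂ} (hz : z ∈ V) (hw : w ∈ V) (n : ℕ) :
    0 < ((pwRot l)^[n] z).im * ((pwRot l)^[n] w).im :=
  same_side_of_isPreconnected hV.isPreconnected (fun _ h i => hV.im_ne_zero h i) hz hw n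

lemma IsTile.iterate_eq (hV : IsTile l V) {z w : ℂ} (hz : z ∈ V) (hw : w ∈ V) (n : ℕ) :
    (pwRot l)^[n] w = (pwRot l)^[n] z + l ^ n * (w - z) :=
  iterate_sub_of_same_side fun k _ => hV.same_side hz hw k

/-- Tiles are convex: they are the interiors of itinerary classes. -/
lemma IsTile.convex (hV : IsTile l V) : Convex ℝ V := by
  obtain ⟨z, hz⟩ := hV.nonempty
  -- These half-planes use the affine continuation along the itinerary of z, which makes C visibly
  -- convex; on C the continuation turns out to be the true orbit.
  set C : Set ℂ := {w | ∀ n : ℕ, 0 < ((pwRot l)^[n] z).im *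
    ((pwRot l)^[n] z + l ^ n * (w - z)).im} with hC
  have hconv : Convex ℝ C := by
    intro x hx y hy a b ha hb hab n
    have e : ((pwRot l)^[n] z + l ^ n * (a • x + b • y - z)).im =
        a * ((pwRot l)^[n] z + l ^ n * (x - z)).im +
          b * ((pwRot l)^[n] z + l ^ n * (y - z)).im := by
      have : (pwRot l)^[n] z + l ^ n * (a • x + b • y - z) =
          a • ((pwRot l)^[n] z + l ^ n * (x - z)) + b • ((pwRot l)^[n] z + l ^ n * (y - z)) := by
        simp only [Complex.real_smul]
        have : (a : ℂ) + b = 1 := by exact_mod_cast hab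
        linear_combination (l ^ n * z - (pwRot l)^[n] z) * this
      rw [this, Complex.add_im, Complex.smul_im, Complex.smul_im, smul_eq_mul, smul_eq_mul]
    rw [e]
    have hx' := hx n
    have hy' := hy n
    rcases ha.eq_or_lt with rfl | ha'
    · have : b = 1 := by linarith
      rw [this]; linarith
    · nlinarith [mul_nonneg hb hy'.le, mul_pos ha' hx']
  have hCside : ∀ w ∈ C, ∀ n : ℕ, 0 < ((pwRot l)^[n] z).im * ((pwRot l)^[n] w).im := by
    intro w hw n
    induction n using Nat.strong_induction_on with
    | _ n ih =>
    rw [iterate_sub_of_same_side ih]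
    exact hw n
  have hVC : V ⊆ interior C := by
    apply interior_maximal _ hV.isOpen
    intro w hw n
    rw [← hV.iterate_eq hz hw]
    exact hV.same_side hz hw n
  have hCV : interior C ⊆ V := by
    apply hV.subset_of_inter hconv.interior.isPreconnected _ (hVC hz) hz
    apply subset_regularSet isOpen_interior
    intro w hw i h0
    have := hCside w (interior_subset hw) i
    rw [h0, mul_zero] at this
    exact this.false
  rw [hVC.antisymm hCV]
  exact hconv.interior

lemma IsTile.image_subset_regularSet (hl : l ≠ 0) (hV : IsTile l V) (n : ℕ) :
    (pwRot l)^[n] '' V ⊆ regularSet l := by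
  obtain ⟨z, hz⟩ := hV.nonempty
  apply subset_regularSet
  · have e : (pwRot l)^[n] '' V = ((Homeomorph.mulLeft₀ (l ^ n) (pow_ne_zero n hl)).trans
        (Homeomorph.addLeft ((pwRot l)^[n] z - l ^ n * z))) '' V := by
      apply Set.image_congr
      intro w hw
      rw [hV.iterate_eq hz hw]
      simp
      ring
    rw [e]
    exact (Homeomorph.isOpenMap _) _ hV.isOpen
  · rintro _ ⟨w, hw, rfl⟩ i
    rw [← Function.iterate_add_apply]
    exact hV.im_ne_zero hw _

lemma IsTile.isPreconnected_image (hV : IsTile l V) (n : ℕ) :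
    IsPreconnected ((pwRot l)^[n] '' V) := by
  obtain ⟨z, hz⟩ := hV.nonempty
  apply hV.isPreconnected.image
  have : ContinuousOn (fun u => (pwRot l)^[n] z + l ^ n * (u - z)) V := by fun_prop
  exact this.congr fun u hu => hV.iterate_eq hz hu n

lemma IsTile.image_subset {W : Set ℂ} (hl : l ≠ 0) (hV : IsTile l V) (hW : IsTile l W) {n : ℕ}
    {z : ℂ} (hz : z ∈ V) (h : (pwRot l)^[n] z ∈ W) : (pwRot l)^[n] '' V ⊆ W :=
  hW.subset_of_inter (hV.isPreconnected_image n) (hV.image_subset_regularSet hl n)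
    (mem_image_of_mem _ hz) h

/-- As l is not real, the heights of u and l * u determine u. -/
lemma norm_le_heights (hl : ‖l‖ = 1) (him : l.im ≠ 0) (u : ℂ) :
    ‖u‖ ≤ 2 / |l.im| * (|u.im| + |(l * u).im|) := by
  have h0 : 0 < |l.im| := abs_pos.2 him
  have h1 : |l.im| ≤ 1 := hl ▸ Complex.abs_im_le_norm l
  have h2 : |l.re| ≤ 1 := hl ▸ Complex.abs_re_le_norm l
  have h3 : |l.im| * |u.re| ≤ |(l * u).im| + |u.im| := by
    rw [← abs_mul, show l.im * u.re = (l * u).im - l.re * u.im by rw [Complex.mul_im]; ring]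
    refine (abs_sub _ _).trans ?_
    rw [abs_mul]
    have := mul_le_mul_of_nonneg_right h2 (abs_nonneg u.im)
    linarith
  have h4 := Complex.norm_le_abs_re_add_abs_im u
  rw [div_mul_eq_mul_div, le_div_iff₀ h0]
  have := abs_nonneg (l * u).im
  have := abs_nonneg u.im
  nlinarith

/-- For u = w - z the area form A n = Im(conj(z_n) l^n u) changes by -s Im(l^n u), with s the side
of z_n. Since w_n is on the same side, this controls |Im(l^n u)| up to 2C. Summing, n‖u‖ is bounded
by a fixed multiple of ‖u‖ plus a multiple of n, so one large n bounds ‖u‖. -/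
lemma IsTile.isBounded {q : ℕ} (hl : IsTameMult l q) (hV : IsTile l V) :
    Bornology.IsBounded V := by
  obtain ⟨z, hz⟩ := hV.nonempty
  obtain ⟨C, hC⟩ := hl.bounded z fun k => hV.im_ne_zero hz k
  have hC0 : 0 ≤ C := (norm_nonneg _).trans (hC 0)
  set D := 2 / |l.im| with hD
  have hD0 : 0 < D := div_pos two_pos (abs_pos.2 hl.im_ne)
  have hll : (starRingEnd ℂ) l * l = 1 := by
    rw [mul_comm, Complex.mul_conj, Complex.normSq_eq_norm_sq, hl.norm_eq]; simp
  obtain ⟨N, hN⟩ := exists_nat_ge (4 * C * D + 1)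
  rw [isBounded_iff_forall_norm_le]
  refine ⟨4 * C * D * N + ‖z‖, fun w hw => ?_⟩
  set u := w - z with hu
  set A : ℕ → ℝ := fun n => ((starRingEnd ℂ) ((pwRot l)^[n] z) * (l ^ n * u)).im with hA
  have hstep : ∀ n, |(l ^ n * u).im| ≤ A n - A (n + 1) + 2 * C := by
    intro n
    obtain ⟨s, hs, hs0, hsH⟩ := stepH_eq ((pwRot l)^[n] z)
    have e : A (n + 1) = A n - s * (l ^ n * u).im := by
      have : (starRingEnd ℂ) ((pwRot l)^[n + 1] z) * (l ^ (n + 1) * u) =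
          (starRingEnd ℂ) ((pwRot l)^[n] z) * (l ^ n * u) - s * (l ^ n * u) := by
        rw [Function.iterate_succ_apply']
        conv_lhs => rw [pwRot]
        rw [hsH, map_mul, map_sub, Complex.conj_ofReal, pow_succ]
        linear_combination (((starRingEnd ℂ) ((pwRot l)^[n] z) - s) * (l ^ n * u)) * hll
      simp only [hA]
      rw [this, Complex.sub_im, Complex.im_ofReal_mul]
    have h1 := hV.same_side hz hw n
    rw [hV.iterate_eq hz hw, Complex.add_im, ← hu] at h1
    have h2 := (abs_le.1 ((Complex.abs_im_le_norm _).trans (hC n)))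
    rw [e]
    rcases hs with rfl | rfl
    · have : 0 < ((pwRot l)^[n] z).im :=
        lt_of_le_of_ne (by linarith) (hV.im_ne_zero hz n).symm
      have h3 := (pos_iff_pos_of_mul_pos h1).1 this
      rw [abs_le]; constructor <;> linarith
    · have : ((pwRot l)^[n] z).im < 0 :=
        lt_of_le_of_ne (by linarith) (hV.im_ne_zero hz n)
      have h3 := (neg_iff_neg_of_mul_pos h1).1 this
      rw [abs_le]; constructor <;> linarith
  have hsum : ∀ n : ℕ, n * ‖u‖ ≤ D * ((A 0 - A n) + (A 1 - A (n + 1)) + 4 * C * n) := by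
    intro n
    induction n with
    | zero => simp
    | succ n ih =>
      have h1 := norm_le_heights hl.norm_eq hl.im_ne (l ^ n * u)
      rw [norm_mul, norm_pow, hl.norm_eq, one_pow, one_mul, ← mul_assoc, ← pow_succ'] at h1
      have h2 := mul_le_mul_of_nonneg_left (add_le_add (hstep n) (hstep (n + 1))) hD0.le
      push_cast
      nlinarith
  have hAb : ∀ n, |A n| ≤ C * ‖u‖ := by
    intro n
    refine (Complex.abs_im_le_norm _).trans ?_
    rw [norm_mul, RCLike.norm_conj, norm_mul, norm_pow, hl.norm_eq, one_pow, one_mul]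
    exact mul_le_mul_of_nonneg_right (hC n) (norm_nonneg _)
  have h := hsum N
  have a0 := abs_le.1 (hAb 0)
  have a1 := abs_le.1 (hAb 1)
  have aN := abs_le.1 (hAb N)
  have aN1 := abs_le.1 (hAb (N + 1))
  have h1 : N * ‖u‖ ≤ D * (4 * (C * ‖u‖) + 4 * C * N) :=
    h.trans (mul_le_mul_of_nonneg_left (by linarith) hD0.le)
  have h2 : ‖u‖ ≤ 4 * C * D * N := by nlinarith [norm_nonneg u]
  have h3 : ‖w‖ ≤ ‖u‖ + ‖z‖ := by
    have := norm_add_le u z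
    rwa [hu, sub_add_cancel] at this
  linarith

lemma IsTameMult.ne_zero {q : ℕ} (hl : IsTameMult l q) : l ≠ 0 := by
  rintro rfl
  exact hl.im_ne rfl

/-- Some iterate of a tile meets the tile. -/
lemma IsTile.exists_return {q : ℕ} (hl : IsTameMult l q) (hV : IsTile l V) {z : ℂ} (hz : z ∈ V) :
    ∃ n : ℕ, 0 < n ∧ (pwRot l)^[n] z ∈ V := by
  obtain ⟨C, hC⟩ := hl.bounded z fun k => hV.im_ne_zero hz k
  obtain ⟨ε, hε, hball⟩ := Metric.isOpen_iff.1 hV.isOpen z hz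
  obtain ⟨a, _, φ, hφ, hlim⟩ := tendsto_subseq_of_bounded (Metric.isBounded_closedBall (x := (0 : ℂ))
    (r := C)) (x := fun n => (pwRot l)^[n] z) (fun n => by simpa using hC n)
  obtain ⟨N, hN⟩ := Metric.cauchySeq_iff.1 hlim.cauchySeq ε hε
  have hd := hN (N + 1) (by omega) N le_rfl
  have hlt : φ N < φ (N + 1) := hφ (Nat.lt_succ_self N)
  simp only [Function.comp] at hd
  set i := φ N
  set j := φ (N + 1)
  -- Two close iterates, pulled back by the isometry at time i, give a point u of V with F^i(u) =
  -- F^j(z); injectivity identifies u with F^(j-i)(z).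
  set u := z + ((pwRot l)^[j] z - (pwRot l)^[i] z) / l ^ i with hu
  have hli : l ^ i ≠ 0 := pow_ne_zero i hl.ne_zero
  have huV : u ∈ V := by
    apply hball
    rw [Metric.mem_ball, dist_eq_norm, hu, add_sub_cancel_left, norm_div, norm_pow, hl.norm_eq,
      one_pow, div_one, ← dist_eq_norm]
    exact hd
  refine ⟨j - i, by omega, ?_⟩
  have h1 : (pwRot l)^[i] u = (pwRot l)^[i] ((pwRot l)^[j - i] z) := by
    rw [← Function.iterate_add_apply, Nat.add_sub_cancel' hlt.le, hV.iterate_eq hz huV, hu,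
      add_sub_cancel_left, mul_div_cancel₀ _ hli]
    ring
  rwa [← (pwRot_injective hl.ne_zero).iterate i h1]

lemma iterate_mem_of_image_subset {n : ℕ} (h : (pwRot l)^[n] '' V ⊆ V) {z : ℂ} (hz : z ∈ V)
    (k : ℕ) : (pwRot l)^[n * k] z ∈ V := by
  induction k with
  | zero => simpa using hz
  | succ k ih =>
    rw [mul_add, mul_one, add_comm, Function.iterate_add_apply]
    exact h (mem_image_of_mem _ ih)

/-- A translation that maps a bounded tile into itself is the identity. -/
lemma IsTile.iterate_eq_self {q : ℕ} (hl : IsTameMult l q) (hV : IsTile l V) {n : ℕ}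
    (hn : l ^ n = 1) (h : (pwRot l)^[n] '' V ⊆ V) {z : ℂ} (hz : z ∈ V) :
    (pwRot l)^[n] z = z := by
  obtain ⟨C, hC⟩ := isBounded_iff_forall_norm_le.1 (hV.isBounded hl)
  set b := (pwRot l)^[n] z - z with hb
  have hk : ∀ k : ℕ, (pwRot l)^[n * k] z = z + k * b := by
    intro k
    induction k with
    | zero => simp
    | succ k ih =>
      rw [mul_add, mul_one, add_comm, Function.iterate_add_apply,
        hV.iterate_eq hz (iterate_mem_of_image_subset h hz k), hn, ih, hb]
      push_cast
      ring
  by_contra hne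
  have hb0 : 0 < ‖b‖ := norm_pos_iff.2 (sub_ne_zero.2 hne)
  obtain ⟨k, hk'⟩ := exists_nat_gt (2 * C / ‖b‖)
  rw [div_lt_iff₀ hb0] at hk'
  have h1 := hC _ (iterate_mem_of_image_subset h hz k)
  have h2 := hC z hz
  have h3 := norm_sub_le ((pwRot l)^[n * k] z) z
  rw [hk, add_sub_cancel_left, norm_mul, Complex.norm_natCast] at h3
  rw [hk] at h1
  linarith

/-- Tiles consist of periodic points. -/
lemma IsTile.exists_period {q : ℕ} (hl : IsTameMult l q) (hV : IsTile l V) :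
    ∃ n : ℕ, 0 < n ∧ (pwRot l)^[n] '' V = V ∧ ∀ z ∈ V, (pwRot l)^[n] z = z := by
  obtain ⟨z, hz⟩ := hV.nonempty
  obtain ⟨n, hn, hret⟩ := hV.exists_return hl hz
  have hsub := hV.image_subset hl.ne_zero hV hz hret
  have hid : ∀ w ∈ V, (pwRot l)^[n * q] w = w := by
    intro w hw
    apply hV.iterate_eq_self hl (by rw [mul_comm, pow_mul, hl.pow_eq, one_pow]) _ hw
    rintro _ ⟨x, hx, rfl⟩
    exact iterate_mem_of_image_subset hsub hx q
  refine ⟨n * q, Nat.mul_pos hn hl.pos, ?_, hid⟩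
  ext w
  constructor
  · rintro ⟨x, hx, rfl⟩
    rwa [hid x hx]
  · exact fun hw => ⟨w, hw, hid w hw⟩

/-- Images of tiles are tiles. -/
lemma IsTile.image {q : ℕ} (hl : IsTameMult l q) (hV : IsTile l V) (i : ℕ) :
    IsTile l ((pwRot l)^[i] '' V) := by
  obtain ⟨z, hz⟩ := hV.nonempty
  have hU := hV.image_subset_regularSet hl.ne_zero i (mem_image_of_mem _ hz)
  refine ⟨_, hU, ?_⟩
  set W := connectedComponentIn (regularSet l) ((pwRot l)^[i] z) with hWdef
  have hW : IsTile l W := ⟨_, hU, rfl⟩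
  have hzW : (pwRot l)^[i] z ∈ W := mem_connectedComponentIn hU
  apply (hV.image_subset hl.ne_zero hW hz hzW).antisymm
  obtain ⟨n, hn, _, hidV⟩ := hV.exists_period hl
  obtain ⟨m, hm, _, hidW⟩ := hW.exists_period hl
  -- A common period of V and W that is at least i: going on for K - i steps takes W back into V.
  set K := n * m * i with hK
  have hiK : i ≤ K := Nat.le_mul_of_pos_left i (Nat.mul_pos hn hm)
  have hKV : (pwRot l)^[K] z = z := by
    rw [hK, mul_assoc, Function.iterate_mul]
    exact Function.iterate_fixed (hidV z hz) _
  have hKW : ∀ w ∈ W, (pwRot l)^[K] w = w := by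
    intro w hw
    rw [hK, mul_comm n m, mul_assoc, Function.iterate_mul]
    exact Function.iterate_fixed (hidW w hw) _
  have hsub : (pwRot l)^[K - i] '' W ⊆ V := by
    apply hW.image_subset hl.ne_zero hV hzW
    rw [← Function.iterate_add_apply, Nat.sub_add_cancel hiK, hKV]
    exact hz
  intro w hw
  refine ⟨(pwRot l)^[K - i] w, hsub (mem_image_of_mem _ hw), ?_⟩
  rw [← Function.iterate_add_apply, Nat.add_sub_cancel' hiK, hKW w hw]

lemma isPeriodicPt_image_iff {n : ℕ} :
    Function.IsPeriodicPt (Set.image (pwRot l)) n V ↔ (pwRot l)^[n] '' V = V := by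
  rw [Function.IsPeriodicPt, Function.IsFixedPt, Set.image_iterate_eq]

lemma IsTile.mem_periodicPts {q : ℕ} (hl : IsTameMult l q) (hV : IsTile l V) :
    V ∈ Function.periodicPts (Set.image (pwRot l)) := by
  obtain ⟨n, hn, h, _⟩ := hV.exists_period hl
  exact ⟨n, hn, isPeriodicPt_image_iff.2 h⟩

lemma IsTile.tilePeriod_pos {q : ℕ} (hl : IsTameMult l q) (hV : IsTile l V) :
    0 < tilePeriod l V :=
  Function.minimalPeriod_pos_of_mem_periodicPts (hV.mem_periodicPts hl)

lemma image_tilePeriod : (pwRot l)^[tilePeriod l V] '' V = V :=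
  isPeriodicPt_image_iff.1 (Function.isPeriodicPt_minimalPeriod _ _)

lemma IsTile.tilePeriod_dvd {q : ℕ} (hl : IsTameMult l q) (hV : IsTile l V) {n : ℕ} {z : ℂ}
    (hz : z ∈ V) (h : (pwRot l)^[n] z ∈ V) : tilePeriod l V ∣ n := by
  apply Function.IsPeriodicPt.minimalPeriod_dvd
  rw [isPeriodicPt_image_iff]
  exact (hV.image hl n).eq_of_inter hV (mem_image_of_mem _ hz) h

lemma IsTile.tilePeriod_image {q : ℕ} (hl : IsTameMult l q) (hV : IsTile l V) (i : ℕ) :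
    tilePeriod l ((pwRot l)^[i] '' V) = tilePeriod l V := by
  have := Function.minimalPeriod_apply_iterate (hV.mem_periodicPts hl) i
  rwa [← Set.image_iterate_eq] at this

lemma IsTile.disjoint_image {q : ℕ} (hl : IsTameMult l q) (hV : IsTile l V) {i j : ℕ}
    (hij : i < j) (hj : j < tilePeriod l V) :
    Disjoint ((pwRot l)^[i] '' V) ((pwRot l)^[j] '' V) := by
  rw [Set.disjoint_left]
  rintro _ ⟨u, hu, rfl⟩ ⟨w, hw, h⟩
  have h1 : (pwRot l)^[i] ((pwRot l)^[j - i] w) = (pwRot l)^[i] u := by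
    rw [← Function.iterate_add_apply, Nat.add_sub_cancel' hij.le, h]
  have h2 := (pwRot_injective hl.ne_zero).iterate i h1
  have h3 := Nat.le_of_dvd (by omega) (hV.tilePeriod_dvd hl hw (n := j - i) (by rwa [h2]))
  omega

lemma IsTameMult.orderOf_pow_pos {q : ℕ} (hl : IsTameMult l q) (n : ℕ) : 0 < orderOf (l ^ n) := by
  rw [orderOf_pos_iff, isOfFinOrder_iff_pow_eq_one]
  exact ⟨q, hl.pos, by rw [← pow_mul, mul_comm, pow_mul, hl.pow_eq, one_pow]⟩

/-- The return map to a tile has a fixed point in the tile. -/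
lemma IsTile.exists_fixed {q : ℕ} (hl : IsTameMult l q) (hV : IsTile l V) :
    ∃ c ∈ V, (pwRot l)^[tilePeriod l V] c = c := by
  obtain ⟨z, hz⟩ := hV.nonempty
  set L := tilePeriod l V with hL
  set k := orderOf (l ^ L) with hk
  have hk0 : 0 < k := hl.orderOf_pow_pos L
  have hkR : (k : ℂ) ≠ 0 := by exact_mod_cast hk0.ne'
  have hsub : (pwRot l)^[L] '' V ⊆ V := (image_tilePeriod (l := l) (V := V)).le
  have hmem := fun j => iterate_mem_of_image_subset hsub hz j
  have hzk : (pwRot l)^[L * k] z = z := by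
    apply hV.iterate_eq_self hl (by rw [pow_mul, hk, pow_orderOf_eq_one]) _ hz
    rintro _ ⟨x, hx, rfl⟩
    exact iterate_mem_of_image_subset hsub hx k
  -- The barycenter of the return orbit lies in V by convexity, and the affine return map, permuting
  -- that orbit, fixes it.
  set c := ∑ j ∈ Finset.range k, (1 / k : ℝ) • (pwRot l)^[L * j] z with hc
  have hcV : c ∈ V := hV.convex.sum_mem (fun _ _ => by positivity)
    (by rw [Finset.sum_const, Finset.card_range, nsmul_eq_mul]; field_simp)
    (fun j _ => hmem j)
  refine ⟨c, hcV, ?_⟩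
  have hkc : (k : ℂ) * c = ∑ j ∈ Finset.range k, (pwRot l)^[L * j] z := by
    rw [hc, ← Finset.smul_sum, Complex.real_smul]
    push_cast
    field_simp
  have hshift : ∑ j ∈ Finset.range k, (pwRot l)^[L * (j + 1)] z =
      ∑ j ∈ Finset.range k, (pwRot l)^[L * j] z := by
    have h1 := Finset.sum_range_succ (fun j => (pwRot l)^[L * j] z) k
    rw [Finset.sum_range_succ'] at h1
    simp only [hzk, mul_zero, Function.iterate_zero, id_eq] at h1
    exact add_right_cancel h1
  have hterm : ∀ j ∈ Finset.range k, (pwRot l)^[L * (j + 1)] z =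
      (pwRot l)^[L] z + l ^ L * ((pwRot l)^[L * j] z - z) := by
    intro j _
    rw [mul_add, mul_one, add_comm, Function.iterate_add_apply, hV.iterate_eq hz (hmem j)]
  rw [Finset.sum_congr rfl hterm, Finset.sum_add_distrib, ← Finset.mul_sum,
    Finset.sum_sub_distrib, Finset.sum_const, Finset.sum_const, Finset.card_range, nsmul_eq_mul,
    nsmul_eq_mul, ← hkc] at hshift
  rw [hV.iterate_eq hz hcV]
  apply mul_left_cancel₀ hkR
  linear_combination hshift

lemma IsTile.isRotationOn (hV : IsTile l V) {q : ℕ} (hl : IsTameMult l q) {n : ℕ} {c : ℂ}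
    (hc : c ∈ V) (h : (pwRot l)^[n] c = c) :
    IsRotationOn ((pwRot l)^[n]) V c (orderOf (l ^ n)) := by
  refine ⟨hl.orderOf_pow_pos n, l ^ n, IsPrimitiveRoot.orderOf _, fun z hz => ?_⟩
  rw [hV.iterate_eq hc hz, h]

lemma IsTile.minimalPeriod_center {q : ℕ} (hl : IsTameMult l q) (hV : IsTile l V) {c : ℂ}
    (hc : c ∈ V) (h : (pwRot l)^[tilePeriod l V] c = c) :
    Function.minimalPeriod (pwRot l) c = tilePeriod l V := by
  apply Nat.dvd_antisymm
  · exact Function.IsPeriodicPt.minimalPeriod_dvd h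
  · apply hV.tilePeriod_dvd hl hc
    rw [Function.iterate_minimalPeriod]
    exact hc

lemma IsTile.minimalPeriod_of_ne {q : ℕ} (hl : IsTameMult l q) (hV : IsTile l V) {c : ℂ}
    (hc : c ∈ V) (h : (pwRot l)^[tilePeriod l V] c = c) {z : ℂ} (hz : z ∈ V) (hzc : z ≠ c) :
    Function.minimalPeriod (pwRot l) z = orderOf (l ^ tilePeriod l V) * tilePeriod l V := by
  set L := tilePeriod l V with hL
  have hiter : ∀ j : ℕ, (pwRot l)^[L * j] z = c + (l ^ L) ^ j * (z - c) := by
    intro j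
    rw [hV.iterate_eq hc hz, pow_mul, Function.iterate_mul, Function.iterate_fixed h]
  apply Nat.dvd_antisymm
  · apply Function.IsPeriodicPt.minimalPeriod_dvd
    rw [Function.IsPeriodicPt, Function.IsFixedPt, mul_comm, hiter, pow_orderOf_eq_one]
    ring
  · obtain ⟨j, hj⟩ := hV.tilePeriod_dvd hl hz (n := Function.minimalPeriod (pwRot l) z)
      (by rw [Function.iterate_minimalPeriod]; exact hz)
    rw [hj, ← hL, mul_comm]
    apply Nat.mul_dvd_mul_left
    apply orderOf_dvd_of_pow_eq_one
    have h1 := hiter j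
    rw [hL, ← hj, Function.iterate_minimalPeriod] at h1
    have h2 : ((l ^ tilePeriod l V) ^ j - 1) * (z - c) = 0 := by linear_combination -h1
    exact sub_eq_zero.1 ((mul_eq_zero.1 h2).resolve_right (sub_ne_zero.2 hzc))

/-- The iterates act on the δ-ball about z as isometries as long as sides agree, so the ball never
reaches the real line. -/
lemma mem_regularSet_of_le {z : ℂ} (hl : ‖l‖ = 1) {δ : ℝ} (hδ : 0 < δ)
    (h : ∀ k : ℕ, δ ≤ |((pwRot l)^[k] z).im|) : z ∈ regularSet l := by
  refine subset_regularSet Metric.isOpen_ball ?_ (Metric.mem_ball_self hδ)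
  intro w hw
  have hside : ∀ k : ℕ, 0 < ((pwRot l)^[k] z).im * ((pwRot l)^[k] w).im := by
    intro k
    induction k using Nat.strong_induction_on with
    | _ k ih =>
    have h1 := h k
    rw [iterate_sub_of_same_side ih, Complex.add_im]
    have h2 : |(l ^ k * (w - z)).im| < δ := by
      refine (Complex.abs_im_le_norm _).trans_lt ?_
      rw [norm_mul, norm_pow, hl, one_pow, one_mul, ← dist_eq_norm]
      exact hw
    rw [abs_lt] at h2
    rcases abs_cases ((pwRot l)^[k] z).im with ⟨h3, h4⟩ | ⟨h3, h4⟩ <;> nlinarith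
  intro i h0
  have := hside i
  rw [h0, mul_zero] at this
  exact this.false

lemma exists_tile {z : ℂ} (hz : z ∈ regularSet l) : ∃ V, IsTile l V ∧ z ∈ V :=
  ⟨_, ⟨z, hz, rfl⟩, mem_connectedComponentIn hz⟩

end Tiles

/-! ### Unbounded periods, the quarter turn, and the theorem -/

lemma isTameMult_rt {Q : ℕ} {r : ℤ} (hQ : 2 ≤ Q) (hr : IsCoprime r Q) :
    IsTameMult (rt Q r) (2 * Q) where
  norm_eq := norm_rt r
  im_ne := by
    have hQ0 : (0 : ℤ) < Q := by omega
    have hrQ : r % Q ≠ 0 := by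
      intro h
      have hd := Int.dvd_of_emod_eq_zero h
      have := Int.isUnit_iff.1 (hr.symm.isUnit_of_dvd' dvd_rfl hd)
      omega
    have h3 := sin_angle_le_sin_mul hQ (j := r % Q)
      (by have := Int.emod_nonneg r hQ0.ne'; omega) (Int.emod_lt_of_pos r hQ0)
    have h4 : (rt Q (r % Q) * 1).im ≠ 0 := by
      rw [mul_one, rt_im]
      linarith [sin_angle_pos hQ]
    simpa using height_ne_zero_congr hQ (Int.emod_emod_of_dvd r dvd_rfl) h4
  pos := by omega
  pow_eq := by
    have h := rt_eq_or_neg hQ (i := 0) (j := r * Q) (by simp)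
    rw [rt_pow, show r * ((2 * Q : ℕ) : ℤ) = r * Q + r * Q by push_cast; ring, rt_add]
    rcases h with h | h <;> rw [h] <;> simp
  bounded := fun _ hz => orbit_bounded hQ hr hz

/-- Period 1 is excluded because a tile lies on one side of the real line. -/
lemma IsTile.tilePeriod_eq_prime {l : ℂ} {q : ℕ} (hl : IsTameMult l q) {V : Set ℂ}
    (hV : IsTile l V) {z : ℂ} (hz : z ∈ V) {p : ℕ} (hp : p.Prime) (hfix : (pwRot l)^[p] z = z)
    (hside : z.im * (pwRot l z).im < 0) : tilePeriod l V = p := by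
  rcases (Nat.dvd_prime hp).1 (hV.tilePeriod_dvd hl hz (n := p) (by rwa [hfix])) with h | h
  · have h1 := image_tilePeriod (l := l) (V := V)
    rw [h, Function.iterate_one] at h1
    have h2 : pwRot l z ∈ V := h1 ▸ mem_image_of_mem (pwRot l) hz
    have h3 := hV.same_side hz h2 0
    simp only [Function.iterate_zero, id_eq] at h3
    linarith
  · exact h

/-- 2Q times the period of a tile is a period of each of its points, so a center without short
periods forces a long tile period. -/
lemma exists_tilePeriod_gt {Q : ℕ} {r : ℤ} (hQ : 2 ≤ Q) (hr : IsCoprime r Q) (N : ℕ) :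
    ∃ V, IsTile (rt Q r) V ∧ N < tilePeriod (rt Q r) V := by
  have hl := isTameMult_rt hQ hr
  obtain ⟨z, hz, hper⟩ := exists_center_long_period hQ hr (N * (2 * Q))
  obtain ⟨V, hV, hzV⟩ := exists_tile
    (mem_regularSet_of_le hl.norm_eq (half_pos (kap_pos hQ)) hz)
  refine ⟨V, hV, ?_⟩
  by_contra! hle
  have hsub : (pwRot (rt Q r))^[tilePeriod (rt Q r) V] '' V ⊆ V := image_tilePeriod.le
  refine hper (tilePeriod (rt Q r) V * (2 * Q))
    (Nat.mul_pos (hV.tilePeriod_pos hl) hl.pos).ne' (Nat.mul_le_mul_right _ hle) ?_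
  apply hV.iterate_eq_self hl (by rw [mul_comm, pow_mul, hl.pow_eq, one_pow]) _ hzV
  rintro _ ⟨x, hx, rfl⟩
  exact iterate_mem_of_image_subset hsub hx _

lemma rotMult_one_four : rotMult 1 4 = I := by
  unfold rotMult
  rw [show ((2 * Real.pi * ((1 : ℕ) : ℝ) / ((4 : ℕ) : ℝ) : ℝ) : ℂ) = Real.pi / 2 by push_cast; ring,
    Complex.exp_pi_div_two_mul_I]

lemma pwRot_I_upper {x y : ℝ} (hy : 0 ≤ y) : pwRot I ⟨x, y⟩ = ⟨-y, x - 1⟩ := by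
  unfold pwRot stepH
  rw [if_pos hy]
  apply Complex.ext <;> simp

lemma pwRot_I_lower {x y : ℝ} (hy : y < 0) : pwRot I ⟨x, y⟩ = ⟨-y, x + 1⟩ := by
  unfold pwRot stepH
  rw [if_neg (not_le.2 hy)]
  apply Complex.ext <;> simp

lemma mem_regularSet_of_finite_orbit {l : ℂ} (hl : ‖l‖ = 1) {δ : ℝ} (hδ : 0 < δ) {S : Set ℂ}
    (hS : ∀ z ∈ S, pwRot l z ∈ S ∧ δ ≤ |z.im|) {z : ℂ} (hz : z ∈ S) : z ∈ regularSet l := by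
  have h : ∀ k : ℕ, (pwRot l)^[k] z ∈ S := by
    intro k
    induction k with
    | zero => exact hz
    | succ k ih => rw [Function.iterate_succ_apply']; exact (hS _ ih).1
  exact mem_regularSet_of_le hl hδ fun k => (hS _ (h k)).2

/-- For the quarter turn there are tiles of period `2` and `3`, with different orders. -/
lemma exists_tiles_quarter_turn {q : ℕ} (hl : IsTameMult I q) :
    ∃ V₁ V₂ : Set ℂ, IsTile I V₁ ∧ IsTile I V₂ ∧ ∃ k₁ k₂ : ℕ, k₁ ≠ k₂ ∧
      (∃ c ∈ V₁, IsRotationOn ((pwRot I)^[tilePeriod I V₁]) V₁ c k₁) ∧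
      (∃ c ∈ V₂, IsRotationOn ((pwRot I)^[tilePeriod I V₂]) V₂ c k₂) := by
  have a1 : pwRot I ⟨1 / 2, 1 / 2⟩ = ⟨-(1 / 2), -(1 / 2)⟩ := by
    rw [pwRot_I_upper (by norm_num)]; norm_num
  have a2 : pwRot I ⟨-(1 / 2), -(1 / 2)⟩ = ⟨1 / 2, 1 / 2⟩ := by
    rw [pwRot_I_lower (by norm_num)]; norm_num
  have b1 : pwRot I ⟨-(1 / 2), 1 / 2⟩ = ⟨-(1 / 2), -(3 / 2)⟩ := by
    rw [pwRot_I_upper (by norm_num)]; norm_num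
  have b2 : pwRot I ⟨-(1 / 2), -(3 / 2)⟩ = ⟨3 / 2, 1 / 2⟩ := by
    rw [pwRot_I_lower (by norm_num)]; norm_num
  have b3 : pwRot I ⟨3 / 2, 1 / 2⟩ = ⟨-(1 / 2), 1 / 2⟩ := by
    rw [pwRot_I_upper (by norm_num)]; norm_num
  have hreg₁ : (⟨1 / 2, 1 / 2⟩ : ℂ) ∈ regularSet I := by
    apply mem_regularSet_of_finite_orbit hl.norm_eq (δ := 1 / 2) (by norm_num)
      (S := {⟨1 / 2, 1 / 2⟩, ⟨-(1 / 2), -(1 / 2)⟩}) _ (by simp)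
    rintro z (rfl | rfl)
    · rw [a1]; exact ⟨by simp, le_abs_self _⟩
    · rw [a2]; exact ⟨by simp, by rw [abs_neg]; exact le_abs_self _⟩
  have hreg₂ : (⟨-(1 / 2), 1 / 2⟩ : ℂ) ∈ regularSet I := by
    apply mem_regularSet_of_finite_orbit hl.norm_eq (δ := 1 / 2) (by norm_num)
      (S := {⟨-(1 / 2), 1 / 2⟩, ⟨-(1 / 2), -(3 / 2)⟩, ⟨3 / 2, 1 / 2⟩}) _ (by simp)
    rintro z (rfl | rfl | rfl)
    · rw [b1]; exact ⟨by simp, le_abs_self _⟩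
    · rw [b2]; exact ⟨by simp, by rw [abs_neg]; exact le_trans (by norm_num) (le_abs_self _)⟩
    · rw [b3]; exact ⟨by simp, le_abs_self _⟩
  obtain ⟨V₁, hV₁, hc₁⟩ := exists_tile hreg₁
  obtain ⟨V₂, hV₂, hc₂⟩ := exists_tile hreg₂
  have f₁ : (pwRot I)^[2] ⟨1 / 2, 1 / 2⟩ = ⟨1 / 2, 1 / 2⟩ := by
    simp only [Function.iterate_succ_apply, Function.iterate_zero, id_eq, a1, a2]
  have f₂ : (pwRot I)^[3] ⟨-(1 / 2), 1 / 2⟩ = ⟨-(1 / 2), 1 / 2⟩ := by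
    simp only [Function.iterate_succ_apply, Function.iterate_zero, id_eq, b1, b2, b3]
  have p₁ := hV₁.tilePeriod_eq_prime hl hc₁ Nat.prime_two f₁ (by rw [a1]; norm_num)
  have p₂ := hV₂.tilePeriod_eq_prime hl hc₂ Nat.prime_three f₂ (by rw [b1]; norm_num)
  refine ⟨V₁, V₂, hV₁, hV₂, orderOf (I ^ 2), orderOf (I ^ 3), ?_, ⟨_, hc₁, ?_⟩, ⟨_, hc₂, ?_⟩⟩
  · intro h
    have h1 : orderOf (I ^ 2) ∣ 2 := orderOf_dvd_of_pow_eq_one (by simp)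
    -- Equal orders would give (i^3)^2 = 1, but i^6 = -1.
    rw [h, orderOf_dvd_iff_pow_eq_one, ← pow_mul, show 3 * 2 = 2 + 4 by rfl, pow_add, I_sq,
      I_pow_four] at h1
    norm_num at h1
  · rw [p₁]; exact hV₁.isRotationOn hl hc₁ f₁
  · rw [p₂]; exact hV₂.isRotationOn hl hc₂ f₂

theorem theoremA :
    (∀ p q : ℕ, 3 ≤ q → Nat.Coprime p q →
      -- every component is open, bounded and periodic, with the stated dynamics on its cycle
      (∀ V : Set ℂ, IsTile (rotMult p q) V →
        IsOpen V ∧ Bornology.IsBounded V ∧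
        V ∈ Function.periodicPts (Set.image (pwRot (rotMult p q))) ∧
        ∃ l k : ℕ, 0 < l ∧ 0 < k ∧ l = tilePeriod (rotMult p q) V ∧
          -- the `l` images `F^i(V)` are pairwise disjoint components, cyclically permuted by `F`
          (∀ i : ℕ, IsTile (rotMult p q) ((pwRot (rotMult p q))^[i] '' V)) ∧
          (∀ i < l, ∀ j < l, i ≠ j →
            Disjoint ((pwRot (rotMult p q))^[i] '' V) ((pwRot (rotMult p q))^[j] '' V)) ∧
          (pwRot (rotMult p q))^[l] '' V = V ∧
          -- on each of them `F^l` is a rotation of order `k` about a center inside it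
          ∀ i < l, ∃ c ∈ (pwRot (rotMult p q))^[i] '' V,
            (pwRot (rotMult p q))^[l] '' ((pwRot (rotMult p q))^[i] '' V) =
              (pwRot (rotMult p q))^[i] '' V ∧
            IsRotationOn ((pwRot (rotMult p q))^[l]) ((pwRot (rotMult p q))^[i] '' V) c k ∧
            Function.minimalPeriod (pwRot (rotMult p q)) c = l ∧
            ∀ z ∈ (pwRot (rotMult p q))^[i] '' V, z ≠ c →
              Function.minimalPeriod (pwRot (rotMult p q)) z = k * l) ∧
      -- the periods of the components are unbounded
      (∀ N : ℕ, ∃ V : Set ℂ, IsTile (rotMult p q) V ∧ N < tilePeriod (rotMult p q) V)) ∧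
    -- the order `k` is in general not the same for all components
    (∃ p q : ℕ, 3 ≤ q ∧ Nat.Coprime p q ∧
      ∃ V₁ V₂ : Set ℂ, IsTile (rotMult p q) V₁ ∧ IsTile (rotMult p q) V₂ ∧
        ∃ k₁ k₂ : ℕ, k₁ ≠ k₂ ∧
          (∃ c ∈ V₁, IsRotationOn ((pwRot (rotMult p q))^[tilePeriod (rotMult p q) V₁]) V₁ c k₁) ∧
          (∃ c ∈ V₂, IsRotationOn ((pwRot (rotMult p q))^[tilePeriod (rotMult p q) V₂]) V₂ c k₂)) := by
  refine ⟨fun p q hq hpq => ?_, 1, 4, by norm_num, by norm_num, ?_⟩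
  · obtain ⟨Q, r, hQ, hr, hrot⟩ := exists_rotMult_eq_rt hq hpq
    rw [hrot]
    have hl := isTameMult_rt hQ hr
    refine ⟨fun V hV => ?_, exists_tilePeriod_gt hQ hr⟩
    refine ⟨hV.isOpen, hV.isBounded hl, hV.mem_periodicPts hl, tilePeriod (rt Q r) V,
      orderOf (rt Q r ^ tilePeriod (rt Q r) V), hV.tilePeriod_pos hl, hl.orderOf_pow_pos _, rfl,
      hV.image hl, fun i hi j hj hij => ?_, image_tilePeriod, fun i _ => ?_⟩
    · rcases lt_or_gt_of_ne hij with h | h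
      · exact hV.disjoint_image hl h hj
      · exact (hV.disjoint_image hl h hi).symm
    · have hW := hV.image hl i
      -- All images share the period of V, so the same ℓ and k serve the whole cycle.
      rw [← hV.tilePeriod_image hl i]
      obtain ⟨c, hc, hfix⟩ := hW.exists_fixed hl
      exact ⟨c, hc, image_tilePeriod, hW.isRotationOn hl hc hfix,
        hW.minimalPeriod_center hl hc hfix,
        fun z hz hzc => hW.minimalPeriod_of_ne hl hc hfix hz hzc⟩
  · obtain ⟨Q, r, hQ, hr, hrot⟩ := exists_rotMult_eq_rt (p := 1) (q := 4) (by norm_num) (by norm_num)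
    have hl := isTameMult_rt hQ hr
    rw [← hrot, rotMult_one_four] at hl
    rw [rotMult_one_four]
    exact exists_tiles_quarter_turn hl
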